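/- An $n$-dimensional crystallographic group is a discrete cocompact subgroup $\Gamma$ of $\mathrm{Isom}(\mathbb E^n)=O(n)\ltimes\mathbb R^n$; it is a Bieberbach group if it is torsion-free. Its lattice subgroup is $\Gamma\cap\mathbb R^n\cong\mathbb Z^n$, its holonomy group is the image of $\Gamma$ in $O(n)$, and its holonomy representation is the action of the holonomy group on the lattice subgroup induced by conjugation. A crystallographic group is of diagonal type if it is isomorphic to a crystallographic group whose holonomy representation is diagonal with respect to some $\mathbb Z$-basis $e_1,\dots,e_n$ of the lattice subgroup, that is, $g\cdot e_i=\pm e_i$ for all $g$ and $i$. For an elementary abelian $2$-group $G$, let the diagonal Vasquez invariant $n_d(G)$ be the smallest integer with the property that, whenever $\Gamma$ is a Bieberbach group of diagonal type (of any dimension) with holonomy group isomorphic to $G$, the lattice subgroup of $\Gamma$ contains a normal subgroup $N$ of $\Gamma$ such that $\Gamma/N$ is isomorphic to a Bieberbach group of diagonal type of dimension at most $n_d(G)$. Theorem. $n_d(C_2)=1$, $n_d(C_2^2)=3$, $n_d(C_2^3)=5$ and $n_d(C_2^4)=10$. -/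

import Mathlib

/-- The isometry group of Euclidean `n`-space: the affine isometries `x ↦ A x + a` with
`A ∈ O(n)` and `a ∈ ℝⁿ`, under composition. -/
abbrev EuclIsom (n : ℕ) : Type :=
  EuclideanSpace ℝ (Fin n) ≃ᵃⁱ[ℝ] EuclideanSpace ℝ (Fin n)

/-- The projection `O(n) ⋉ ℝⁿ → O(n)`, `(A, a) ↦ A`. -/
noncomputable def linearPart (n : ℕ) :
    EuclIsom n →* (EuclideanSpace ℝ (Fin n) ≃ₗᵢ[ℝ] EuclideanSpace ℝ (Fin n)) where
  toFun g := g.linearIsometryEquiv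
  map_one' := rfl
  map_mul' _ _ := rfl

/-- The pair `(A, a)` of an isometry `x ↦ A x + a`. The group `O(n) ⋉ ℝⁿ` carries the topology
that this injection into `End(ℝⁿ) × ℝⁿ` induces. -/
noncomputable def isomPair (n : ℕ) (g : EuclIsom n) :
    (EuclideanSpace ℝ (Fin n) →L[ℝ] EuclideanSpace ℝ (Fin n)) × EuclideanSpace ℝ (Fin n) :=
  (((linearPart n g).toContinuousLinearEquiv :
    EuclideanSpace ℝ (Fin n) →L[ℝ] EuclideanSpace ℝ (Fin n)), g 0)

/-- `n`-dimensional crystallographic groups: discrete cocompact subgroups of the isometry group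
of Euclidean `n`-space. -/
structure IsCrystallographic {n : ℕ} (Γ : Subgroup (EuclIsom n)) : Prop where
  discrete : DiscreteTopology (isomPair n '' (Γ : Set (EuclIsom n)))
  cocompact : ∃ K : Set (EuclideanSpace ℝ (Fin n)), IsCompact K ∧ ∀ x, ∃ γ ∈ Γ, γ x ∈ K

/-- `n`-dimensional Bieberbach groups: torsion-free crystallographic groups. -/
structure IsBieberbach {n : ℕ} (Γ : Subgroup (EuclIsom n)) : Prop extends
    IsCrystallographic Γ where
  torsionFree : ∀ γ ∈ Γ, ∀ m : ℕ, 0 < m → γ ^ m = 1 → γ = 1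

/-- The lattice subgroup `Γ ∩ ℝⁿ`: the elements of `Γ` with trivial linear part. -/
noncomputable def latticeSubgroup {n : ℕ} (Γ : Subgroup (EuclIsom n)) : Subgroup Γ :=
  ((linearPart n).comp Γ.subtype).ker

/-- The holonomy group: the image of `Γ` in `O(n)`. -/
noncomputable def holonomyGroup {n : ℕ} (Γ : Subgroup (EuclIsom n)) :
    Subgroup (EuclideanSpace ℝ (Fin n) ≃ₗᵢ[ℝ] EuclideanSpace ℝ (Fin n)) :=
  Γ.map (linearPart n)

/-- The holonomy representation of `Γ` on the lattice `Γ ∩ ℝⁿ ≅ ℤⁿ` is diagonal (hence with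
diagonal entries `±1`) for a suitable `ℤ`-basis `b` of that lattice. The basis need not be
orthogonal. As conjugating the translation by `v` with `γ` gives the translation by `A v`, where
`A` is the linear part of `γ`, the holonomy representation is the action of the linear parts. -/
def HasDiagonalHolonomy {n : ℕ} (Γ : Subgroup (EuclIsom n)) : Prop :=
  ∃ b : Module.Basis (Fin n) ℝ (EuclideanSpace ℝ (Fin n)),
    (∀ v : EuclideanSpace ℝ (Fin n),
      AffineIsometryEquiv.constVAdd ℝ (EuclideanSpace ℝ (Fin n)) v ∈ Γ ↔
        v ∈ Submodule.span ℤ (Set.range b)) ∧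
    ∀ γ ∈ Γ, ∀ i, linearPart n γ (b i) = b i ∨ linearPart n γ (b i) = -b i

/-- `Γ` is of diagonal type: it is isomorphic to a crystallographic group whose holonomy
representation is diagonal. -/
def IsDiagonalType {n : ℕ} (Γ : Subgroup (EuclIsom n)) : Prop :=
  ∃ Γ' : Subgroup (EuclIsom n),
    IsCrystallographic Γ' ∧ HasDiagonalHolonomy Γ' ∧ Nonempty (Γ ≃* Γ')

/-- The abstract group `H` is (isomorphic to) a `d`-dimensional Bieberbach group of diagonal
type. -/
def IsDiagonalBieberbachGroup (d : ℕ) (H : Type) [Group H] : Prop :=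
  ∃ Γ : Subgroup (EuclIsom d), IsBieberbach Γ ∧ IsDiagonalType Γ ∧ Nonempty (H ≃* Γ)

/-- The property of `m` whose least instance is the diagonal Vasquez invariant of `G`: for every
Bieberbach group `Γ` of diagonal type, of any dimension, with holonomy group isomorphic to `G`,
the lattice subgroup contains a normal subgroup `N` of `Γ` such that `Γ / N` is a Bieberbach
group of diagonal type of dimension at most `m`. -/
def DiagonalVasquezBound (G : Type) [Group G] (m : ℕ) : Prop :=
  ∀ (n : ℕ) (Γ : Subgroup (EuclIsom n)),
    IsBieberbach Γ → IsDiagonalType Γ → Nonempty (holonomyGroup Γ ≃* G) →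
      ∃ (N : Subgroup Γ) (_ : N.Normal), N ≤ latticeSubgroup Γ ∧
        ∃ d ≤ m, IsDiagonalBieberbachGroup d (Γ ⧸ N)

/-- `m` is the diagonal Vasquez invariant `n_d(G)`. -/
def IsDiagonalVasquezInvariant (G : Type) [Group G] (m : ℕ) : Prop :=
  IsLeast {m : ℕ | DiagonalVasquezBound G m} m

/-- The elementary abelian `2`-group `C₂ᵏ`. -/
abbrev C2Pow (k : ℕ) : Type := Fin k → Multiplicative (ZMod 2)

/-! After a choice of origin, a diagonal Bieberbach group with holonomy `C₂ᵏ` is a family of pairs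
`(χ i, α i)` of functionals on `𝔽₂ᵏ`: an element over `v` acts on the coordinate `i` by `y ↦ (-1)^(χ
i v) y + x / 2` with `x ≡ α i v` mod 2 (`exists_diagModel`). Torsion-freeness means that every `v ≠
0` is covered, that is, `χ i v = 0` and `α i v = 1` for some `i`. Faithfulness of the holonomy means
that the radical, the common kernel of the `χ i`, is zero.

Upper bound. Dropping a coordinate, possibly after adding it to others with the same character,
divides out part of the lattice, and is allowed as long as the family still covers. Once no such
step is left, each coordinate has a private point that it alone covers, and counting points of `𝔽₂ᵏ`
bounds the number of coordinates. In rank four each coordinate also covers three non-private points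
whose sum is its private point; hence `r` coordinates satisfy `r ≤ (15 - r).choose 3`, which forces
`r ≤ 10` (`card_le_ten`). The reduced family may have a nonzero radical. Its translations then
include half-integral vectors and may lack a diagonal basis. Restoring at most one old coordinate
per dimension of the radical repairs this (`IsQuotient.exists_radical_eq_bot`), so the number to
bound is coordinates plus radical dimension (`IsReduced.card_add_finrank_le`). If all characters
vanish, no repair is needed.

Lower bound. If `Γ / N` is torsion-free, then `N` contains all roots of its elements. Suppose that a
coordinate has a private point `p` and shares its character with no other. A translation in `N` that
moves this coordinate can be conjugated and multiplied into a multiple of a unit translation, which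
has a root over `p`; this root would lie in `N` without being a translation. Hence such coordinates
survive in the quotient (`DiagonalVasquezBound.le_of_private`), and explicit families give 1, 3, 5
and 10. -/

/-- The elementary abelian `2`-group of rank `k`, written additively. -/
abbrev BoolVec (k : ℕ) : Type := Fin k → ZMod 2

/-- Linear functionals on `BoolVec k`. -/
abbrev BoolDual (k : ℕ) : Type := Module.Dual (ZMod 2) (BoolVec k)

/-- A family of pairs `(χ i, α i)` of functionals on `𝔽₂ᵏ`: the sign characters and the half
translations of a diagonal crystallographic group. -/
structure DiagData (k : ℕ) (ι : Type) where
  chi : ι → BoolDual k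
  alpha : ι → BoolDual k

/-! ### Linear algebra over `𝔽₂` -/

lemma zmod_two_eq_one {a : ZMod 2} (h : a ≠ 0) : a = 1 := by
  revert a; decide

lemma boolVec_add_self {k : ℕ} (v : BoolVec k) : v + v = 0 := by
  funext i; exact CharTwo.add_self_eq_zero _

lemma boolVec_add_ne_zero {k : ℕ} {v w : BoolVec k} (h : v ≠ w) : v + w ≠ 0 := by
  intro h0
  apply h
  have := congrArg (· + w) h0
  simpa [add_assoc, boolVec_add_self] using this

lemma exists_ne_zero_forall_eq_zero {k r : ℕ} (s : Fin r → BoolDual k) (h : r < k) :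
    ∃ v : BoolVec k, v ≠ 0 ∧ ∀ i, s i v = 0 := by
  have hk : LinearMap.ker (LinearMap.pi s) ≠ ⊥ :=
    LinearMap.ker_ne_bot_of_finrank_lt (by simpa using h)
  obtain ⟨v, hv, hv0⟩ := Submodule.exists_mem_ne_zero_of_ne_bot hk
  refine ⟨v, hv0, fun i => ?_⟩
  exact congrFun (LinearMap.mem_ker.1 hv) i

lemma exists_dual_eq_one {k : ℕ} {v : BoolVec k} (h : v ≠ 0) : ∃ f : BoolDual k, f v = 1 := by
  obtain ⟨i, hi⟩ := Function.ne_iff.1 h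
  exact ⟨LinearMap.proj i, zmod_two_eq_one hi⟩

lemma card_ker {k : ℕ} {f : BoolDual k} (hf : f ≠ 0) :
    (Finset.univ.filter fun v : BoolVec k => f v = 0).card = 2 ^ (k - 1) := by
  classical
  have h1 := Module.Dual.finrank_ker_add_one_of_ne_zero hf
  rw [Module.finrank_fin_fun] at h1
  have h2 := Module.card_eq_pow_finrank (K := ZMod 2) (V := LinearMap.ker f)
  rw [ZMod.card, show Module.finrank (ZMod 2) (LinearMap.ker f) = k - 1 by omega] at h2
  rw [← h2, ← Fintype.card_subtype]
  exact Fintype.card_congr (Equiv.refl _)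

/-! ### Covers, reduced families and private points -/

namespace DiagData

variable {k : ℕ} {ι κ τ : Type}

/-- The elements `v` that are moved by a half translation along the coordinate `i`. -/
def Covers (L : DiagData k ι) (i : ι) (v : BoolVec k) : Prop :=
  L.chi i v = 0 ∧ L.alpha i v = 1

def IsCover (L : DiagData k ι) : Prop := ∀ v, v ≠ 0 → ∃ i, L.Covers i v

/-- The common kernel of the characters. -/
def radical (L : DiagData k ι) : Submodule (ZMod 2) (BoolVec k) := ⨅ i, LinearMap.ker (L.chi i)

lemma mem_radical {L : DiagData k ι} {v : BoolVec k} : v ∈ L.radical ↔ ∀ i, L.chi i v = 0 := by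
  simp [radical]

/-- Add the coordinate `i` to the coordinates in `T` and drop it. -/
noncomputable def collapse (L : DiagData k ι) (i : ι) (T : Set ι) : DiagData k {j // j ≠ i} :=
  open Classical in
  { chi := fun j => L.chi j
    alpha := fun j => L.alpha j + if (j : ι) ∈ T then L.alpha i else 0 }

/-- `T = ∅` is plain deletion. Equality of characters is what makes the addition of coordinates
equivariant. -/
structure IsReduced (L : DiagData k ι) : Prop where
  isCover : L.IsCover
  not_isCover_collapse : ∀ (i : ι) (T : Set ι), (∀ j ∈ T, L.chi j = L.chi i) →
    ¬ (L.collapse i T).IsCover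

/-- `p` selects for each coordinate a point that no other coordinate covers. -/
def IsPrivate (L : DiagData k ι) (p : ι → BoolVec k) : Prop := ∀ i j, L.Covers j (p i) ↔ j = i

/-- Deleting `i` uncovers some point; since the whole family covers it, `i` is its only coverer. -/
lemma IsReduced.exists_isPrivate {L : DiagData k ι} (hL : L.IsReduced) :
    ∃ p, L.IsPrivate p := by
  have : ∀ i, ∃ v, ∀ j, L.Covers j v ↔ j = i := by
    intro i
    have h := hL.not_isCover_collapse i ∅ (by simp)
    simp only [IsCover, not_forall, not_exists] at h
    obtain ⟨v, hv, h⟩ := h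
    have key : ∀ j, L.Covers j v → j = i := by
      intro j hj
      by_contra hne
      exact h ⟨j, hne⟩ (by simpa [Covers, collapse] using hj)
    obtain ⟨j, hj⟩ := hL.isCover v hv
    refine ⟨v, fun l => ⟨key l, ?_⟩⟩
    rintro rfl
    rwa [← key j hj]
  choose p hp using this
  exact ⟨p, hp⟩

namespace IsPrivate

variable {L : DiagData k ι} {p : ι → BoolVec k}

lemma chi_self (hp : L.IsPrivate p) (i : ι) : L.chi i (p i) = 0 := ((hp i i).2 rfl).1

lemma alpha_self (hp : L.IsPrivate p) (i : ι) : L.alpha i (p i) = 1 := ((hp i i).2 rfl).2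

lemma ne_zero (hp : L.IsPrivate p) (i : ι) : p i ≠ 0 := by
  intro h
  have := hp.alpha_self i
  simp [h] at this

lemma injective (hp : L.IsPrivate p) : Function.Injective p := by
  intro i j h
  exact (hp j i).1 (h ▸ (hp i i).2 rfl)

lemma alpha_eq_zero (hp : L.IsPrivate p) {i j : ι} (hij : j ≠ i) (h : L.chi j (p i) = 0) :
    L.alpha j (p i) = 0 := by
  by_contra h1
  exact hij ((hp i j).1 ⟨h, zmod_two_eq_one h1⟩)

/-- Source of the counting: translating `p i` by `ker (χ i) ∩ ker (α i)` gives further points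
covered by `i`, and by `add_ne` a nonzero shift never hits a chosen private point. -/
lemma covers_add (hp : L.IsPrivate p) {i : ι} {h : BoolVec k} (h1 : L.chi i h = 0)
    (h2 : L.alpha i h = 0) : L.Covers i (p i + h) := by
  constructor
  · rw [map_add, hp.chi_self, h1, add_zero]
  · rw [map_add, hp.alpha_self, h2, add_zero]

lemma add_ne (hp : L.IsPrivate p) {i : ι} {h : BoolVec k} (h0 : h ≠ 0) (h1 : L.chi i h = 0)
    (h2 : L.alpha i h = 0) (j : ι) : p j ≠ p i + h := by
  intro he
  have hij : i = j := (hp j i).1 (he ▸ hp.covers_add h1 h2)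
  subst hij
  exact h0 (by simpa using he.symm)

lemma add_ne_zero (hp : L.IsPrivate p) {i : ι} {h : BoolVec k} (h1 : L.chi i h = 0)
    (h2 : L.alpha i h = 0) : p i + h ≠ 0 := by
  intro h0
  have := (hp.covers_add h1 h2).2
  simp [h0] at this

lemma card_le [Fintype ι] (hp : L.IsPrivate p) : Fintype.card ι ≤ 2 ^ k - 1 := by
  classical
  have h1 : (Finset.univ.image p) ⊆ Finset.univ.erase (0 : BoolVec k) := by
    intro v hv
    obtain ⟨i, -, rfl⟩ := Finset.mem_image.1 hv
    simp [hp.ne_zero i]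
  have h2 := Finset.card_le_card h1
  rw [Finset.card_image_of_injective _ hp.injective, Finset.card_erase_of_mem (by simp)] at h2
  simpa using h2

/-- The other private points lie in the kernel of `α i` if `χ i = 0`. -/
lemma alpha_eq_zero_of_chi_eq_zero (hp : L.IsPrivate p) {i j : ι} (hi : L.chi i = 0)
    (hij : i ≠ j) : L.alpha i (p j) = 0 := hp.alpha_eq_zero hij (by simp [hi])

/-- All private points but `p i` are nonzero vectors of the hyperplane `α i = 0`. -/
lemma card_le_of_chi_eq_zero [Fintype ι] (hp : L.IsPrivate p) {i : ι} (hi : L.chi i = 0) :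
    Fintype.card ι ≤ 2 ^ (k - 1) := by
  classical
  have hne : L.alpha i ≠ 0 := by
    intro h
    have := hp.alpha_self i
    simp [h] at this
  have h1 : ((Finset.univ.erase i).image p) ⊆
      (Finset.univ.filter fun v : BoolVec k => L.alpha i v = 0).erase 0 := by
    intro v hv
    obtain ⟨j, hj, rfl⟩ := Finset.mem_image.1 hv
    have hj : j ≠ i := by simpa using hj
    simp [hp.ne_zero j, hp.alpha_eq_zero_of_chi_eq_zero hi hj.symm]
  have h2 := Finset.card_le_card h1
  rw [Finset.card_image_of_injective _ hp.injective, Finset.card_erase_of_mem (by simp),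
    Finset.card_erase_of_mem (by simp), card_ker hne, Finset.card_univ] at h2
  have : 0 < 2 ^ (k - 1) := by positivity
  omega

/-- If moreover some other coordinate covers a point of the kernel of `α i` besides its private
one, then the bound improves by one. -/
lemma card_lt_of_chi_eq_zero [Fintype ι] (hp : L.IsPrivate p) {i j : ι} (hi : L.chi i = 0)
    (hij : i ≠ j) {h : BoolVec k} (h0 : h ≠ 0) (h1 : L.chi j h = 0) (h2 : L.alpha j h = 0)
    (h3 : L.alpha i h = 0) : Fintype.card ι < 2 ^ (k - 1) := by
  classical
  have hne : L.alpha i ≠ 0 := by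
    intro h
    have := hp.alpha_self i
    simp [h] at this
  have hq : p j + h ∈ (Finset.univ.filter fun v : BoolVec k => L.alpha i v = 0).erase 0 := by
    simp only [Finset.mem_erase, Finset.mem_filter, Finset.mem_univ, true_and]
    exact ⟨hp.add_ne_zero h1 h2, by
      rw [map_add, hp.alpha_eq_zero_of_chi_eq_zero hi hij, h3, add_zero]⟩
  have h1 : ((Finset.univ.erase i).image p) ⊆
      ((Finset.univ.filter fun v : BoolVec k => L.alpha i v = 0).erase 0).erase (p j + h) := by
    intro v hv
    obtain ⟨l, hl, rfl⟩ := Finset.mem_image.1 hv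
    have hl : l ≠ i := by simpa using hl
    simp [hp.ne_zero l, hp.alpha_eq_zero_of_chi_eq_zero hi hl.symm, hp.add_ne h0 h1 h2 l]
  have h2 := Finset.card_le_card h1
  have h5 : 0 < ((Finset.univ.filter fun v : BoolVec k => L.alpha i v = 0).erase 0).card :=
    Finset.card_pos.2 ⟨_, hq⟩
  rw [Finset.card_image_of_injective _ hp.injective, Finset.card_erase_of_mem (by simp),
    Finset.card_erase_of_mem hq] at h2
  rw [Finset.card_erase_of_mem (by simp), card_ker hne] at h2 h5
  rw [Finset.card_univ] at h2
  omega

/-- Among coordinates with a common character, the `α j` are dual to the private points. -/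
lemma linearIndependent_fiber (hp : L.IsPrivate p) (ψ : BoolDual k) :
    LinearIndependent (ZMod 2) fun j : {j // L.chi j = ψ} => p j := by
  classical
  rw [linearIndependent_iff']
  intro s g hg i hi
  have h := congrArg (L.alpha i) hg
  rw [map_sum, map_zero, Finset.sum_eq_single i] at h
  · simpa [hp.alpha_self] using h
  · intro j _ hji
    have : L.alpha i (p j) = 0 := by
      refine hp.alpha_eq_zero (fun h => hji (Subtype.ext h.symm)) ?_
      rw [show L.chi i = L.chi j from i.2.trans j.2.symm]; exact hp.chi_self j
    simp [this]
  · intro h; exact absurd hi h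

lemma card_le_of_forall_chi_eq_zero [Fintype ι] (hp : L.IsPrivate p) (h : ∀ i, L.chi i = 0) :
    Fintype.card ι ≤ k := by
  classical
  have h1 := (hp.linearIndependent_fiber 0).fintype_card_le_finrank
  rw [Module.finrank_fin_fun] at h1
  refine le_trans (le_of_eq ?_) h1
  exact Fintype.card_congr (Equiv.subtypeUnivEquiv h).symm

end IsPrivate

end DiagData

/-! ### Fibres of a character, and radicals of codimension at most two -/

namespace DiagData

variable {k : ℕ} {ι κ τ : Type}

namespace IsPrivate

variable {L : DiagData k ι} {p : ι → BoolVec k}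

/-- The private points of the fibre are independent in `ker ψ`, of dimension `k - 1`. In a full
fibre they form a basis of `ker ψ` whose dual basis is given by the `α j`, so these separate points.
-/
lemma card_fiber_le [Fintype ι] [DecidableEq (BoolDual k)] (hp : L.IsPrivate p) {ψ : BoolDual k}
    (hψ : ψ ≠ 0) :
    (Finset.univ.filter fun j => L.chi j = ψ).card ≤ k - 1 ∧
    ((Finset.univ.filter fun j => L.chi j = ψ).card = k - 1 →
      ∀ g, ψ g = 0 → (∀ j, L.chi j = ψ → L.alpha j g = 0) → g = 0) := by
  have hli := hp.linearIndependent_fiber ψ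
  have h1 := finrank_span_eq_card hli
  rw [Fintype.card_subtype] at h1
  have h2 := Module.Dual.finrank_ker_add_one_of_ne_zero hψ
  rw [Module.finrank_fin_fun] at h2
  have hle : Submodule.span (ZMod 2) (Set.range fun j : {j // L.chi j = ψ} => p j) ≤
      LinearMap.ker ψ := by
    rw [Submodule.span_le]
    rintro _ ⟨j, rfl⟩
    have := hp.chi_self j
    rw [j.2] at this
    exact this
  refine ⟨?_, fun h g hg hz => ?_⟩
  · have := Submodule.finrank_mono hle
    omega
  · have he := Submodule.eq_of_le_of_finrank_eq hle (by omega)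
    have hgm : g ∈ Submodule.span (ZMod 2) (Set.range fun j : {j // L.chi j = ψ} => p j) := by
      rw [he]; exact hg
    obtain ⟨c, rfl⟩ := (Submodule.mem_span_range_iff_exists_fun _).1 hgm
    refine Finset.sum_eq_zero fun i _ => ?_
    have h3 := hz i i.2
    rw [map_sum, Finset.sum_eq_single i] at h3
    · have : c i = 0 := by simpa [hp.alpha_self] using h3
      rw [this, zero_smul]
    · intro j _ hji
      have : L.alpha i (p j) = 0 := by
        refine hp.alpha_eq_zero (fun h => hji (Subtype.ext h.symm)) ?_
        rw [show L.chi i = L.chi j from i.2.trans j.2.symm]; exact hp.chi_self j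
      simp [this]
    · intro h; exact absurd (Finset.mem_univ _) h

end IsPrivate

/-- In a reduced family a character `ψ` whose half translations separate the kernel of `ψ`
shares no covered point with another character. -/
lemma IsReduced.not_covers_of_separating {L : DiagData k ι} (hL : L.IsReduced) {ψ : BoolDual k}
    (hψ : ∀ g, ψ g = 0 → (∀ j, L.chi j = ψ → L.alpha j g = 0) → g = 0) {a : BoolVec k}
    (ha : a ≠ 0) (haψ : ψ a = 0) {l : ι} (hl : L.chi l ≠ ψ) : ¬ L.Covers l a := by
  classical
  intro hla
  have hi : ∃ i, L.chi i = ψ ∧ L.alpha i a = 1 := by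
    by_contra h
    push Not at h
    refine ha (hψ a haψ fun j hj => ?_)
    by_contra h1
    exact h j hj (zmod_two_eq_one h1)
  obtain ⟨i, hi, hia⟩ := hi
  -- After this collapse the half translations of the fibre all vanish at `a`, and they still
  -- separate `ker ψ` modulo `a`. Only `a` loses its cover within the fibre, and `l` covers `a`.
  refine hL.not_isCover_collapse i {j | L.chi j = ψ ∧ L.alpha j a = 1}
    (fun j hj => hj.1.trans hi.symm) ?_
  have hother : ∀ j v, L.chi j ≠ ψ → L.Covers j v →
      ∃ j, (L.collapse i {j | L.chi j = ψ ∧ L.alpha j a = 1}).Covers j v := by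
    intro j v hj hv
    refine ⟨⟨j, fun h => hj (h ▸ hi)⟩, hv.1, ?_⟩
    simp [collapse, hj, hv.2]
  intro v hv
  by_cases hva : v = a
  · subst hva
    exact hother l _ hl hla
  obtain ⟨j, hj⟩ := hL.isCover v hv
  by_cases hjψ : L.chi j = ψ
  swap
  · exact hother j _ hjψ hj
  have hvψ : ψ v = 0 := by rw [← hjψ]; exact hj.1
  by_contra hn
  have hz : ∀ j, j ≠ i → L.chi j = ψ →
      L.alpha j v + (if L.alpha j a = 1 then L.alpha i v else 0) = 0 := by
    intro j hji hjψ
    by_contra h1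
    refine hn ⟨⟨j, hji⟩, ?_, ?_⟩
    · simpa [collapse, hjψ] using hvψ
    · have := zmod_two_eq_one h1
      by_cases hja : L.alpha j a = 1 <;> simpa [collapse, hjψ, hja] using this
  by_cases hiv : L.alpha i v = 0
  · refine hv (hψ v hvψ fun j hjψ => ?_)
    by_cases hji : j = i
    · rw [hji, hiv]
    · simpa [hiv] using hz j hji hjψ
  · have hiv := zmod_two_eq_one hiv
    refine boolVec_add_ne_zero hva (hψ (v + a) (by rw [map_add, hvψ, haψ, add_zero])
      fun j hjψ => ?_)
    rw [map_add]
    by_cases hji : j = i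
    · rw [hji, hiv, hia]; rfl
    · have := hz j hji hjψ
      by_cases hja : L.alpha j a = 0
      · simpa [hja] using this
      · have hja := zmod_two_eq_one hja
        rw [if_pos hja, hiv] at this
        rw [hja, this]

/-- The radical and one nonzero vector `v` span everything, so the character of a coordinate
covering `v` vanishes. -/
lemma IsCover.exists_chi_eq_zero {L : DiagData k ι} (hL : L.IsCover)
    (hk : 0 < k) (h : k ≤ Module.finrank (ZMod 2) L.radical + 1) : ∃ i, L.chi i = 0 := by
  have hv : ∃ v : BoolVec k, v ≠ 0 ∧ L.radical ⊔ Submodule.span (ZMod 2) {v} = ⊤ := by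
    by_cases ht : L.radical = ⊤
    · refine ⟨fun _ => 1, ?_, by simp [ht]⟩
      intro h0
      exact one_ne_zero (congrFun h0 ⟨0, hk⟩)
    · obtain ⟨v, -, hv⟩ := SetLike.exists_of_lt (lt_top_iff_ne_top.2 ht)
      refine ⟨v, fun h => hv (h ▸ Submodule.zero_mem _), ?_⟩
      apply Submodule.eq_top_of_finrank_eq
      have hlt : L.radical < L.radical ⊔ Submodule.span (ZMod 2) {v} := by
        refine lt_of_le_of_ne le_sup_left fun he => hv ?_
        rw [he]
        exact Submodule.mem_sup_right (Submodule.mem_span_singleton_self v)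
      have h1 := Submodule.finrank_lt_finrank_of_lt hlt
      have h2 := Submodule.finrank_le (L.radical ⊔ Submodule.span (ZMod 2) {v})
      rw [Module.finrank_fin_fun] at h2 ⊢
      omega
  obtain ⟨v, hv, htop⟩ := hv
  obtain ⟨i, hi⟩ := hL v hv
  refine ⟨i, ?_⟩
  have : LinearMap.ker (L.chi i) = ⊤ := by
    rw [eq_top_iff, ← htop, sup_le_iff]
    refine ⟨iInf_le _ i, ?_⟩
    rw [Submodule.span_singleton_le_iff_mem]
    exact hi.1
  exact LinearMap.ker_eq_top.1 this

lemma card_dualAnnihilator_radical (L : DiagData k ι)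
    (h : Module.finrank (ZMod 2) L.radical + 2 = k) :
    Nat.card L.radical.dualAnnihilator = 4 := by
  have h1 := Subspace.finrank_add_finrank_dualAnnihilator_eq L.radical
  rw [Module.finrank_fin_fun] at h1
  have h2 := Module.natCard_eq_pow_finrank (K := ZMod 2) (V := L.radical.dualAnnihilator)
  rw [h2, Nat.card_zmod, show Module.finrank (ZMod 2) L.radical.dualAnnihilator = 2 by omega]
  rfl

/-- The characters are nonzero elements of a four-element annihilator, so at most three occur. Two
full fibres cannot coexist: both would cover a nonzero radical vector, against
`not_covers_of_separating`. The total is at most `(k - 1) + 2 (k - 2)`. -/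
lemma IsReduced.card_le_of_finrank_radical [Fintype ι] {L : DiagData k ι} (hL : L.IsReduced)
    (hk : 3 ≤ k) (h : Module.finrank (ZMod 2) L.radical + 2 = k) (h0 : ∀ i, L.chi i ≠ 0) :
    Fintype.card ι + 5 ≤ 3 * k := by
  classical
  obtain ⟨p, hp⟩ := hL.exists_isPrivate
  have : Finite (BoolDual k) := Finite.of_injective _ DFunLike.coe_injective
  have : Fintype (BoolDual k) := Fintype.ofFinite _
  set I := Finset.univ.image L.chi with hI
  have hIcard : I.card ≤ 3 := by
    have hA : (Finset.univ.filter fun f : BoolDual k => f ∈ L.radical.dualAnnihilator).card =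
        4 := by
      rw [← card_dualAnnihilator_radical L h, Nat.card_eq_fintype_card, ← Fintype.card_subtype]
    have hsub : insert 0 I ⊆
        Finset.univ.filter fun f : BoolDual k => f ∈ L.radical.dualAnnihilator := by
      intro f hf
      simp only [Finset.mem_filter, Finset.mem_univ, true_and, Submodule.mem_dualAnnihilator]
      rcases Finset.mem_insert.1 hf with rfl | hf
      · simp
      · obtain ⟨i, -, rfl⟩ := Finset.mem_image.1 hf
        exact fun w hw => mem_radical.1 hw i
    have h1 := Finset.card_le_card hsub
    rw [Finset.card_insert_of_notMem (by simp [hI, h0])] at h1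
    omega
  have hsum := Finset.card_eq_sum_card_image L.chi (Finset.univ : Finset ι)
  rw [Finset.card_univ, ← hI] at hsum
  have hI0 : ∀ ψ ∈ I, ψ ≠ 0 := by
    intro ψ hψ
    obtain ⟨i, -, rfl⟩ := Finset.mem_image.1 hψ
    exact h0 i
  have hfib := fun ψ (hψ : ψ ∈ I) => hp.card_fiber_le (hI0 ψ hψ)
  obtain ⟨a, ha, ha0⟩ : ∃ a ∈ L.radical, a ≠ 0 := by
    apply Submodule.exists_mem_ne_zero_of_ne_bot
    intro hb
    rw [hb, finrank_bot] at h
    omega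
  have hrad : ∀ ψ ∈ I, ψ a = 0 := by
    intro ψ hψ
    obtain ⟨i, -, rfl⟩ := Finset.mem_image.1 hψ
    exact mem_radical.1 ha i
  by_cases hfull : ∃ ψ ∈ I, (Finset.univ.filter fun j => L.chi j = ψ).card = k - 1
  · obtain ⟨ψ, hψ, hfull⟩ := hfull
    rw [← Finset.add_sum_erase I _ hψ, hfull] at hsum
    have hle : ∑ x ∈ I.erase ψ, (Finset.univ.filter fun j => L.chi j = x).card ≤
        (I.erase ψ).card • (k - 2) := by
      refine Finset.sum_le_card_nsmul _ _ _ fun φ hφ => ?_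
      have hφI := Finset.mem_of_mem_erase hφ
      have h1 := (hfib φ hφI).1
      by_contra hlt
      have hφfull := (hfib φ hφI).2 (by omega)
      have hcov : ∃ j, L.chi j = φ ∧ L.alpha j a = 1 := by
        by_contra hn
        push Not at hn
        refine ha0 (hφfull a (hrad φ hφI) fun j hj => ?_)
        by_contra h1
        exact hn j hj (zmod_two_eq_one h1)
      obtain ⟨j, hj, hja⟩ := hcov
      refine hL.not_covers_of_separating ((hfib ψ hψ).2 hfull) ha0 (hrad ψ hψ) (l := j) ?_
        ⟨by rw [hj]; exact hrad φ hφI, hja⟩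
      rw [hj]; exact Finset.ne_of_mem_erase hφ
    rw [Finset.card_erase_of_mem hψ, smul_eq_mul] at hle
    have : (I.card - 1) * (k - 2) ≤ 2 * (k - 2) := Nat.mul_le_mul_right _ (by omega)
    omega
  · push Not at hfull
    have hle : ∑ x ∈ I, (Finset.univ.filter fun j => L.chi j = x).card ≤ I.card • (k - 2) := by
      refine Finset.sum_le_card_nsmul _ _ _ fun φ hφ => ?_
      have h1 := (hfib φ hφ).1
      have h2 := hfull φ hφ
      omega
    rw [smul_eq_mul] at hle
    have : I.card * (k - 2) ≤ 3 * (k - 2) := Nat.mul_le_mul_right _ hIcard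
    omega

end DiagData

/-! ### Rank four: at most ten coordinates, and the case of equality -/

/-- Adding `p` exchanges the two values of `α` on the eight points of `ker χ`. -/
lemma card_level {χ α : BoolDual 4} (hχ : χ ≠ 0) {p : BoolVec 4} (h1 : χ p = 0) (h2 : α p = 1) :
    (Finset.univ.filter fun v : BoolVec 4 => χ v = 0 ∧ α v = 1).card = 4 := by
  classical
  have hsplit := Finset.card_filter_add_card_filter_not
    (s := Finset.univ.filter fun v : BoolVec 4 => χ v = 0) (fun v => α v = 1)
  rw [card_ker hχ, Finset.filter_filter, Finset.filter_filter] at hsplit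
  have heq : (Finset.univ.filter fun v : BoolVec 4 => χ v = 0 ∧ α v = 1).card =
      (Finset.univ.filter fun v : BoolVec 4 => χ v = 0 ∧ ¬ α v = 1).card := by
    refine Finset.card_bij (fun v _ => v + p) ?_ ?_ ?_
    · intro v hv
      simp only [Finset.mem_filter, Finset.mem_univ, true_and, map_add] at hv ⊢
      rw [hv.1, hv.2, h1, h2]
      decide
    · intro v _ w _ h
      exact add_right_cancel h
    · intro v hv
      simp only [Finset.mem_filter, Finset.mem_univ, true_and] at hv
      refine ⟨v + p, ?_, by rw [add_assoc, boolVec_add_self, add_zero]⟩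
      have : α v = 0 := by
        by_contra h
        exact hv.2 (zmod_two_eq_one h)
      simp [hv.1, this, h1, h2]
  norm_num at hsplit
  omega

namespace DiagData

variable {ι : Type}

namespace IsPrivate

section RankFour

variable [Fintype ι] {L : DiagData 4 ι} {p : ι → BoolVec 4}

/-- The nonzero points that are not the chosen private point of a coordinate. -/
noncomputable def rest (p : ι → BoolVec 4) : Finset (BoolVec 4) :=
  open Classical in (Finset.univ.erase 0) \ Finset.univ.image p

lemma mem_rest {v : BoolVec 4} : v ∈ rest p ↔ v ≠ 0 ∧ ∀ j, p j ≠ v := by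
  simp [rest]

lemma card_rest (hp : L.IsPrivate p) : (rest p).card + Fintype.card ι = 15 := by
  classical
  have hsub : Finset.univ.image p ⊆ Finset.univ.erase (0 : BoolVec 4) := by
    intro v hv
    obtain ⟨i, -, rfl⟩ := Finset.mem_image.1 hv
    simp [hp.ne_zero i]
  have h := Finset.card_sdiff_add_card_eq_card hsub
  rw [Finset.card_image_of_injective _ hp.injective, Finset.card_erase_of_mem (by simp)] at h
  simpa [rest] using h

/-- `ker (χ i) ∩ ker (α i)` contains a plane `{0, h, g, h + g}`; the triple is its translate by `p
i` without `p i`. The sum is `3 p i = p i`. -/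
lemma exists_triple (hp : L.IsPrivate p) (i : ι) :
    ∃ T ∈ (rest p).powersetCard 3, ∑ v ∈ T, v = p i ∧ ∀ v ∈ T, L.Covers i v := by
  classical
  obtain ⟨h, h0, hh⟩ := exists_ne_zero_forall_eq_zero ![L.chi i, L.alpha i] (by norm_num)
  obtain ⟨f, hf⟩ := exists_dual_eq_one h0
  obtain ⟨g, g0, hg⟩ := exists_ne_zero_forall_eq_zero ![L.chi i, L.alpha i, f] (by norm_num)
  have hχ : L.chi i h = 0 := hh 0
  have hα : L.alpha i h = 0 := hh 1
  have gχ : L.chi i g = 0 := hg 0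
  have gα : L.alpha i g = 0 := hg 1
  have gf : f g = 0 := hg 2
  have hgh : h ≠ g := by
    rintro rfl
    rw [hf] at gf
    exact one_ne_zero gf
  have s0 : h + g ≠ 0 := boolVec_add_ne_zero hgh
  have sχ : L.chi i (h + g) = 0 := by rw [map_add, hχ, gχ, add_zero]
  have sα : L.alpha i (h + g) = 0 := by rw [map_add, hα, gα, add_zero]
  have n1 : p i + h ≠ p i + g := fun h => hgh (add_left_cancel h)
  have n2 : p i + h ≠ p i + (h + g) := fun h => g0 (by simpa using add_left_cancel h)
  have n3 : p i + g ≠ p i + (h + g) := fun h => h0 (by simpa using add_left_cancel h)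
  refine ⟨{p i + h, p i + g, p i + (h + g)}, ?_, ?_, ?_⟩
  · rw [Finset.mem_powersetCard]
    refine ⟨?_, Finset.card_eq_three.2 ⟨_, _, _, n1, n2, n3, rfl⟩⟩
    intro v hv
    simp only [Finset.mem_insert, Finset.mem_singleton] at hv
    rcases hv with rfl | rfl | rfl
    · exact mem_rest.2 ⟨hp.add_ne_zero hχ hα, hp.add_ne h0 hχ hα⟩
    · exact mem_rest.2 ⟨hp.add_ne_zero gχ gα, hp.add_ne g0 gχ gα⟩
    · exact mem_rest.2 ⟨hp.add_ne_zero sχ sα, hp.add_ne s0 sχ sα⟩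
  · rw [Finset.sum_insert (by simp [n1, n2]), Finset.sum_insert (by simp [n3]),
      Finset.sum_singleton]
    have e1 := boolVec_add_self (p i)
    have e2 := boolVec_add_self h
    have e3 := boolVec_add_self g
    calc p i + h + (p i + g + (p i + (h + g)))
        = p i + (p i + p i) + (h + h) + (g + g) := by abel
      _ = p i := by rw [e1, e2, e3]; simp
  · intro v hv
    simp only [Finset.mem_insert, Finset.mem_singleton] at hv
    rcases hv with rfl | rfl | rfl
    · exact hp.covers_add hχ hα
    · exact hp.covers_add gχ gα
    · exact hp.covers_add sχ sα

/-- The sum of a triple recovers the private point, hence the coordinate. -/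
lemma card_le_choose (hp : L.IsPrivate p) {T : ι → Finset (BoolVec 4)}
    (hT : ∀ i, T i ∈ (rest p).powersetCard 3) (hs : ∀ i, ∑ v ∈ T i, v = p i) :
    Function.Injective T ∧ Fintype.card ι ≤ ((rest p).card).choose 3 := by
  classical
  have hinj : Function.Injective T := by
    intro i j h
    apply hp.injective
    rw [← hs, ← hs, h]
  refine ⟨hinj, ?_⟩
  rw [← Finset.card_powersetCard, ← Finset.card_univ, ← Finset.card_image_of_injective _ hinj]
  apply Finset.card_le_card
  intro t ht
  obtain ⟨i, -, rfl⟩ := Finset.mem_image.1 ht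
  exact hT i

lemma card_le_ten (hp : L.IsPrivate p) : Fintype.card ι ≤ 10 := by
  choose T hT hs _ using hp.exists_triple
  have h1 := (hp.card_le_choose hT hs).2
  have h2 := hp.card_rest
  by_contra! h
  have h3 : (rest p).card ≤ 4 := by omega
  have h4 := Nat.choose_le_choose 3 h3
  have : Nat.choose 4 3 = 4 := rfl
  omega

/-- With ten coordinates there are five non-private points, and each of their ten triples belongs to
a coordinate. Four of the points turn out to be a basis whose dual basis consists of characters. -/
lemma radical_eq_bot_of_card_eq_ten (hp : L.IsPrivate p) (h0 : ∀ i, L.chi i ≠ 0)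
    (hc : Fintype.card ι = 10) : L.radical = ⊥ := by
  classical
  choose T hT hs hcov using hp.exists_triple
  have hinj := (hp.card_le_choose hT hs).1
  have hE : (rest p).card = 5 := by have := hp.card_rest; omega
  have himg : Finset.univ.image T = (rest p).powersetCard 3 := by
    apply Finset.eq_of_subset_of_card_le
    · intro t ht
      obtain ⟨i, -, rfl⟩ := Finset.mem_image.1 ht
      exact hT i
    · rw [Finset.card_image_of_injective _ hinj, Finset.card_powersetCard, hE, Finset.card_univ,
        hc]
      rfl
  obtain ⟨S, hS, hS4⟩ := Finset.exists_subset_card_eq (s := rest p) (n := 4) (by omega)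
  let e' := (S.equivFinOfCardEq hS4).symm
  let e : Fin 4 → BoolVec 4 := fun i => e' i
  have heS : ∀ i, e i ∈ rest p := fun i => hS (e' i).2
  have he : Function.Injective e := fun i j h => e'.injective (Subtype.ext h)
  have hrow : ∀ i, ∃ r, T r = (Finset.univ.erase i).image e := by
    intro i
    have : (Finset.univ.erase i).image e ∈ (rest p).powersetCard 3 := by
      rw [Finset.mem_powersetCard, Finset.card_image_of_injective _ he,
        Finset.card_erase_of_mem (Finset.mem_univ _)]
      refine ⟨fun v hv => ?_, rfl⟩
      obtain ⟨j, -, rfl⟩ := Finset.mem_image.1 hv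
      exact heS j
    rw [← himg] at this
    obtain ⟨r, -, hr⟩ := Finset.mem_image.1 this
    exact ⟨r, hr⟩
  choose r hr using hrow
  have hcv : ∀ i j, j ≠ i → L.Covers (r i) (e j) := by
    intro i j hji
    apply hcov
    rw [hr]
    exact Finset.mem_image_of_mem _ (by simp [hji])
  have hsum : ∀ i, ∑ j ∈ Finset.univ.erase i, e j = p (r i) := by
    intro i
    rw [← hs, hr, Finset.sum_image (fun _ _ _ _ h => he h)]
  have hlevel : ∀ i v, L.Covers (r i) v → v = p (r i) ∨ ∃ j, j ≠ i ∧ e j = v := by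
    intro i v hv
    have hsub : insert (p (r i)) (T (r i)) ⊆
        Finset.univ.filter fun v => L.chi (r i) v = 0 ∧ L.alpha (r i) v = 1 := by
      intro w hw
      simp only [Finset.mem_filter, Finset.mem_univ, true_and]
      rcases Finset.mem_insert.1 hw with rfl | hw
      · exact ⟨hp.chi_self _, hp.alpha_self _⟩
      · exact hcov _ _ hw
    have hTm := Finset.mem_powersetCard.1 (hT (r i))
    have hn : p (r i) ∉ T (r i) := fun h => (mem_rest.1 (hTm.1 h)).2 _ rfl
    have heq := Finset.eq_of_subset_of_card_le hsub (by
      rw [card_level (h0 _) (hp.chi_self _) (hp.alpha_self _), Finset.card_insert_of_notMem hn,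
        hTm.2])
    have hv' : v ∈ insert (p (r i)) (T (r i)) := by
      rw [heq]; simpa [Covers] using hv
    rcases Finset.mem_insert.1 hv' with h | h
    · exact Or.inl h
    · rw [hr] at h
      obtain ⟨j, hj, rfl⟩ := Finset.mem_image.1 h
      exact Or.inr ⟨j, by simpa using hj, rfl⟩
  have hfour : ∀ i j l : Fin 4, ∃ m, m ≠ i ∧ m ≠ j ∧ m ≠ l := by decide
  -- Otherwise `e i + e j` would lie in the four-point level set of `r i`, so it would be `p (r i)`
  -- or some `e l`. Evaluating `α (r j)`, respectively `α (r m)` with a fourth index `m`, excludes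
  -- both by parity.
  have hdiag : ∀ i, L.chi (r i) (e i) = 1 := by
    intro i
    by_contra hne
    have hz : L.chi (r i) (e i) = 0 := by
      by_contra h
      exact hne (zmod_two_eq_one h)
    have hα : L.alpha (r i) (e i) = 0 := by
      by_contra h
      rcases hlevel i (e i) ⟨hz, zmod_two_eq_one h⟩ with h | ⟨j, hj, h⟩
      · exact (mem_rest.1 (heS i)).2 _ h.symm
      · exact hj (he h)
    obtain ⟨j, hji⟩ := exists_ne i
    have hjc := hcv i j hji
    rcases hlevel i (e i + e j) ⟨by rw [map_add, hz, hjc.1, add_zero],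
      by rw [map_add, hα, hjc.2, zero_add]⟩ with h | ⟨l, hl, h⟩
    · rw [← hsum, ← Finset.add_sum_erase _ _ (show j ∈ Finset.univ.erase i by simp [hji]),
        add_comm] at h
      have h := congrArg (L.alpha (r j)) (add_left_cancel h)
      rw [(hcv j i hji.symm).2, map_sum, Finset.sum_congr rfl
        (fun t ht => (hcv j t (Finset.ne_of_mem_erase ht)).2), Finset.sum_const,
        Finset.card_erase_of_mem (by simp [hji]), Finset.card_erase_of_mem (by simp)] at h
      revert h; decide
    · have hlj : l ≠ j := by
        rintro rfl
        exact (mem_rest.1 (heS i)).1 (by simpa using h)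
      obtain ⟨m, hmi, hmj, hml⟩ := hfour i j l
      have h := congrArg (L.alpha (r m)) h
      rw [map_add, (hcv m l hml.symm).2, (hcv m i hmi.symm).2, (hcv m j hmj.symm).2] at h
      revert h; decide
  have hli : LinearIndependent (ZMod 2) e := by
    rw [Fintype.linearIndependent_iff]
    intro g hg i
    have h := congrArg (L.chi (r i)) hg
    rw [map_sum, map_zero, Finset.sum_eq_single i] at h
    · simpa [hdiag] using h
    · intro j _ hji
      simp [(hcv i j hji).1]
    · simp
  have hspan := hli.span_eq_top_of_card_eq_finrank' (by simp)
  rw [eq_bot_iff]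
  intro a ha
  have ha' : a ∈ Submodule.span (ZMod 2) (Set.range e) := by rw [hspan]; trivial
  obtain ⟨c, rfl⟩ := (Submodule.mem_span_range_iff_exists_fun _).1 ha'
  rw [Submodule.mem_bot]
  refine Finset.sum_eq_zero fun i _ => ?_
  have h := mem_radical.1 ha (r i)
  rw [map_sum, Finset.sum_eq_single i] at h
  · have : c i = 0 := by simpa [hdiag] using h
    rw [this, zero_smul]
  · intro j _ hji
    simp [(hcv i j hji).1]
  · simp

end RankFour

end IsPrivate

end DiagData

/-! ### The bound on coordinates plus radical dimension -/

namespace DiagData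

variable {k : ℕ} {ι κ τ : Type}

section Bounds

lemma forall_chi_eq_zero_of_le_finrank {L : DiagData k ι}
    (h : k ≤ Module.finrank (ZMod 2) L.radical) (i : ι) : L.chi i = 0 := by
  have htop : L.radical = ⊤ := by
    apply Submodule.eq_top_of_finrank_eq
    have := Submodule.finrank_le L.radical
    rw [Module.finrank_fin_fun] at this ⊢
    omega
  refine LinearMap.ext fun v => ?_
  exact mem_radical.1 (htop ▸ Submodule.mem_top) i

variable [Fintype ι]

/-- With six private points among seven nonzero ones, the single remaining point would be covered by
every coordinate, hence lie in the radical. -/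
lemma IsPrivate.card_le_five {L : DiagData 3 ι} {p : ι → BoolVec 3} (hp : L.IsPrivate p)
    (hr : L.radical = ⊥) : Fintype.card ι ≤ 5 := by
  classical
  have : ∀ i, ∃ h, h ≠ 0 ∧ L.chi i h = 0 ∧ L.alpha i h = 0 := by
    intro i
    obtain ⟨h, h0, hh⟩ := exists_ne_zero_forall_eq_zero ![L.chi i, L.alpha i] (by norm_num)
    exact ⟨h, h0, hh 0, hh 1⟩
  choose h h0 hχ hα using this
  by_contra! hc
  obtain ⟨i⟩ : Nonempty ι := Fintype.card_pos_iff.1 (by omega)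
  have hmem : ∀ j, p j + h j ∈ Finset.univ.erase (0 : BoolVec 3) := by
    intro j
    simp [hp.add_ne_zero (hχ j) (hα j)]
  have hsub : Finset.univ.image p ⊆ (Finset.univ.erase (0 : BoolVec 3)).erase (p i + h i) := by
    intro v hv
    obtain ⟨j, -, rfl⟩ := Finset.mem_image.1 hv
    simp [hp.ne_zero j, hp.add_ne (h0 i) (hχ i) (hα i) j]
  have heq := Finset.eq_of_subset_of_card_le hsub (by
    rw [Finset.card_image_of_injective _ hp.injective, Finset.card_erase_of_mem (hmem i),
      Finset.card_erase_of_mem (by simp), Finset.card_univ, Finset.card_univ]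
    simp only [Fintype.card_fun, ZMod.card, Fintype.card_fin]
    omega)
  have hall : ∀ j, p j + h j = p i + h i := by
    intro j
    by_contra hne
    have : p j + h j ∈ Finset.univ.image p := by
      rw [heq]
      exact Finset.mem_erase.2 ⟨hne, hmem j⟩
    obtain ⟨l, -, hl⟩ := Finset.mem_image.1 this
    exact hp.add_ne (h0 j) (hχ j) (hα j) l hl
  have hrad : p i + h i ∈ L.radical := mem_radical.2 fun j => by
    rw [← hall j]; exact (hp.covers_add (hχ j) (hα j)).1
  rw [hr] at hrad
  exact hp.add_ne_zero (hχ i) (hα i) ((Submodule.mem_bot _).1 hrad)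

lemma IsPrivate.card_le_three {L : DiagData 3 ι} {p : ι → BoolVec 3} (hp : L.IsPrivate p)
    (hr : Module.finrank (ZMod 2) L.radical = 2) {i : ι} (hi : L.chi i = 0) :
    Fintype.card ι ≤ 3 := by
  classical
  by_cases hone : ∃ j, j ≠ i ∧ L.chi j = 0
  · obtain ⟨j, hji, hj⟩ := hone
    obtain ⟨h, h0, hh⟩ := exists_ne_zero_forall_eq_zero ![L.alpha i, L.alpha j] (by norm_num)
    have := hp.card_lt_of_chi_eq_zero hi hji.symm h0 (by simp [hj]) (hh 1) (hh 0)
    omega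
  push Not at hone
  -- All other characters now share one kernel. With four coordinates the private points other than
  -- `p i` fill the hyperplane `α i = 0`, so `h` is one of them and lies in that kernel.
  have hker : ∀ j, j ≠ i → LinearMap.ker (L.chi j) = L.radical := by
    intro j hj
    refine (Submodule.eq_of_le_of_finrank_eq
      (show L.radical ≤ LinearMap.ker (L.chi j) from iInf_le _ j) ?_).symm
    have := Module.Dual.finrank_ker_add_one_of_ne_zero (hone j hj)
    rw [Module.finrank_fin_fun] at this
    omega
  by_contra! hc
  have : Nontrivial ι := Fintype.one_lt_card_iff_nontrivial.1 (by omega)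
  obtain ⟨j, hj⟩ := exists_ne i
  obtain ⟨h, h0, hh⟩ := exists_ne_zero_forall_eq_zero ![L.alpha i, L.alpha j] (by norm_num)
  have hne : L.alpha i ≠ 0 := by
    intro h
    have := hp.alpha_self i
    simp [h] at this
  have hsub : ((Finset.univ.erase i).image p) ⊆
      (Finset.univ.filter fun v : BoolVec 3 => L.alpha i v = 0).erase 0 := by
    intro v hv
    obtain ⟨l, hl, rfl⟩ := Finset.mem_image.1 hv
    have hl : l ≠ i := by simpa using hl
    simp [hp.ne_zero l, hp.alpha_eq_zero_of_chi_eq_zero hi hl.symm]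
  have heq := Finset.eq_of_subset_of_card_le hsub (by
    rw [Finset.card_image_of_injective _ hp.injective, Finset.card_erase_of_mem (by simp),
      Finset.card_erase_of_mem (by simp), card_ker hne, Finset.card_univ]
    norm_num
    omega)
  have hmem : h ∈ (Finset.univ.erase i).image p := by
    rw [heq]
    have : L.alpha i h = 0 := hh 0
    simp [h0, this]
  obtain ⟨l, hl, rfl⟩ := Finset.mem_image.1 hmem
  have hl : l ≠ i := by simpa using hl
  have hχ : p l ∈ LinearMap.ker (L.chi j) := by
    rw [hker j hj, ← hker l hl]
    exact hp.chi_self l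
  have := hp.card_lt_of_chi_eq_zero hi hj.symm h0 hχ (hh 1) (hh 0)
  omega

/-- The value of the diagonal Vasquez invariant of `C₂ᵏ` for `1 ≤ k ≤ 4`. -/
def vasquezValue : ℕ → ℕ
  | 1 => 1
  | 2 => 3
  | 3 => 5
  | _ => 10

/-- Without a zero character the radical has codimension at least two. The sums that attain the
bound are 1 + 0 in rank one; 2 + 1 and 3 + 0 in rank two; 4 + 1, 3 + 2 and 5 + 0 in rank three; 7 +
3, 9 + 1 and 10 + 0 in rank four. -/
lemma IsReduced.card_add_finrank_le {L : DiagData k ι} (hL : L.IsReduced) (hk1 : 1 ≤ k)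
    (hk4 : k ≤ 4) :
    ((∀ i, L.chi i = 0) ∧ Fintype.card ι ≤ vasquezValue k) ∨
      Fintype.card ι + Module.finrank (ZMod 2) L.radical ≤ vasquezValue k := by
  obtain ⟨p, hp⟩ := hL.exists_isPrivate
  by_cases hall : ∀ i, L.chi i = 0
  · refine Or.inl ⟨hall, (hp.card_le_of_forall_chi_eq_zero hall).trans ?_⟩
    interval_cases k <;> simp [vasquezValue]
  right
  have hw : Module.finrank (ZMod 2) L.radical < k := by
    by_contra! h
    exact hall (forall_chi_eq_zero_of_le_finrank h)
  by_cases hz : ∃ i, L.chi i = 0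
  · obtain ⟨i, hi⟩ := hz
    have hc := hp.card_le_of_chi_eq_zero hi
    interval_cases k
    · norm_num at hc; simp only [vasquezValue]; omega
    · norm_num at hc; simp only [vasquezValue]; omega
    · have := hp.card_le_three (i := i)
      norm_num at hc
      simp only [vasquezValue]
      by_cases h2 : Module.finrank (ZMod 2) L.radical = 2
      · have := this h2 hi
        omega
      · omega
    · push Not at hall
      obtain ⟨j, hj⟩ := hall
      have hij : i ≠ j := by
        rintro rfl
        exact hj hi
      obtain ⟨h, h0, hh⟩ := exists_ne_zero_forall_eq_zero ![L.chi j, L.alpha j, L.alpha i]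
        (by norm_num)
      have := hp.card_lt_of_chi_eq_zero hi hij h0 (hh 0) (hh 1) (hh 2)
      norm_num at this
      simp only [vasquezValue]
      omega
  · have hw1 : Module.finrank (ZMod 2) L.radical + 1 < k := by
      by_contra! h
      exact hz (hL.isCover.exists_chi_eq_zero (by omega) h)
    push Not at hz
    interval_cases k
    · omega
    · have := hp.card_le
      norm_num at this
      simp only [vasquezValue]
      omega
    · by_cases h1 : Module.finrank (ZMod 2) L.radical = 1
      · have := hL.card_le_of_finrank_radical (by norm_num) (by omega) hz
        norm_num [vasquezValue]
        omega
      · have h0 : Module.finrank (ZMod 2) L.radical = 0 := by omega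
        have := hp.card_le_five (Submodule.finrank_eq_zero.1 h0)
        norm_num [vasquezValue]
        omega
    · by_cases h2 : Module.finrank (ZMod 2) L.radical = 2
      · have := hL.card_le_of_finrank_radical (by norm_num) (by omega) hz
        norm_num [vasquezValue]
        omega
      · have h10 := hp.card_le_ten
        by_cases h : Fintype.card ι = 10
        · rw [hp.radical_eq_bot_of_card_eq_ten hz h, finrank_bot, h]
          simp [vasquezValue]
        · norm_num [vasquezValue]
          omega

end Bounds

/-! ### Equivariant quotients of families -/

/-- The sign `(-1)ᵃ`. -/
def sgn (a : ZMod 2) : ℤ := if a = 0 then 1 else -1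

/-- There is an equivariant surjection of lattices `ℤ^ι → ℤ^κ` that maps the half translations of
`L` to those of `L'`. -/
def IsQuotient (L : DiagData k ι) (L' : DiagData k κ) : Prop :=
  ∃ F : (ι → ℤ) →+ (κ → ℤ), Function.Surjective F ∧
    (∀ v x, F (fun i => sgn (L.chi i v) * x i) = fun j => sgn (L'.chi j v) * F x j) ∧
    ∀ v x, (∀ i, (x i : ZMod 2) = L.alpha i v) → ∀ j, (F x j : ZMod 2) = L'.alpha j v

lemma IsQuotient.refl (L : DiagData k ι) : L.IsQuotient L :=
  ⟨AddMonoidHom.id _, Function.surjective_id, fun _ _ => rfl, fun _ _ h => h⟩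

lemma IsQuotient.trans {L : DiagData k ι} {L' : DiagData k κ} {L'' : DiagData k τ}
    (h : L.IsQuotient L') (h' : L'.IsQuotient L'') : L.IsQuotient L'' := by
  obtain ⟨F, hF, hs, hp⟩ := h
  obtain ⟨F', hF', hs', hp'⟩ := h'
  refine ⟨F'.comp F, hF'.comp hF, fun v x => ?_, fun v x hx => hp' v _ (hp v x hx)⟩
  simp only [AddMonoidHom.comp_apply]
  rw [hs, hs']

lemma isQuotient_collapse (L : DiagData k ι) (i : ι) (T : Set ι)
    (hT : ∀ j ∈ T, L.chi j = L.chi i) : L.IsQuotient (L.collapse i T) := by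
  classical
  refine ⟨{ toFun := fun x j => x j + if (j : ι) ∈ T then x i else 0
            map_zero' := by ext; simp
            map_add' := fun x y => by
              ext j
              simp only [Pi.add_apply]
              split_ifs <;> ring }, ?_, ?_, ?_⟩
  · intro y
    refine ⟨fun j => if h : j = i then 0 else y ⟨j, h⟩, ?_⟩
    ext j
    simp [j.2]
  · intro v x
    ext j
    simp only [AddMonoidHom.coe_mk, ZeroHom.coe_mk, collapse]
    split_ifs with h
    · rw [hT j h]; ring
    · ring
  · intro v x hx j
    by_cases h : (j : ι) ∈ T <;> simp [collapse, h, hx]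

lemma exists_isReduced (L : DiagData k ι) : ∀ (n : ℕ) (κ : Type) [Fintype κ]
    (L' : DiagData k κ), Fintype.card κ = n → L.IsQuotient L' → L'.IsCover →
      ∃ (τ : Type) (_ : Fintype τ) (L'' : DiagData k τ), L.IsQuotient L'' ∧ L''.IsReduced := by
  classical
  intro n
  induction n using Nat.strong_induction_on with
  | _ n ih =>
    intro κ _ L' hn hq hc
    by_cases h : ∃ (i : κ) (T : Set κ), (∀ j ∈ T, L'.chi j = L'.chi i) ∧ (L'.collapse i T).IsCover
    · obtain ⟨i, T, hT, hc'⟩ := h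
      refine ih _ ?_ {j // j ≠ i} (L'.collapse i T) rfl
        (hq.trans (L'.isQuotient_collapse i T hT)) hc'
      rw [← hn]
      exact Fintype.card_subtype_lt (x := i) (by simp)
    · push Not at h
      exact ⟨κ, inferInstance, L', hq, hc, h⟩

/-- Add a coordinate of `L` to a quotient of `L`. -/
def adjoin (L' : DiagData k κ) (L : DiagData k ι) (e : ι) : DiagData k (Option κ) where
  chi := fun j => j.elim (L.chi e) L'.chi
  alpha := fun j => j.elim (L.alpha e) L'.alpha

lemma IsQuotient.adjoin {L : DiagData k ι} {L' : DiagData k κ} (h : L.IsQuotient L') {e : ι}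
    {a : BoolVec k} (ha : a ∈ L'.radical) (he : L.chi e a ≠ 0) :
    L.IsQuotient (L'.adjoin L e) := by
  classical
  obtain ⟨F, hF, hs, hp⟩ := h
  -- `a` negates this vector but acts trivially on the target. So the coordinate `e` can be
  -- prescribed independently of `F`, which gives surjectivity.
  have hFe : ∀ t, F (Pi.single e t) = 0 := by
    intro t
    have h := hs a (Pi.single e t)
    have h1 : (fun i => sgn (L.chi i a) * (Pi.single e t : ι → ℤ) i) = -Pi.single e t := by
      ext i
      by_cases hi : i = e
      · subst hi; simp [sgn, he]
      · simp [hi]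
    rw [h1, map_neg] at h
    ext j
    have h2 := congrFun h j
    simp only [mem_radical.1 ha j, sgn, Pi.neg_apply, if_true, one_mul] at h2
    simp only [Pi.zero_apply]
    omega
  refine ⟨{ toFun := fun x j => j.elim (x e) (F x)
            map_zero' := by ext j; cases j <;> simp
            map_add' := fun x y => by ext j; cases j <;> simp }, ?_, ?_, ?_⟩
  · intro y
    obtain ⟨x, hx⟩ := hF fun j => y (some j)
    refine ⟨x + Pi.single e (y none - x e), ?_⟩
    ext j
    cases j with
    | none => simp
    | some j => simp [hFe, hx]
  · intro v x
    ext j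
    cases j with
    | none => simp [DiagData.adjoin]
    | some j => simp [DiagData.adjoin, hs]
  · intro v x hx j
    cases j with
    | none => simp [DiagData.adjoin, hx]
    | some j => simpa [DiagData.adjoin] using hp v x hx j

/-- Each adjoined coordinate moves some vector of the radical, so the radical shrinks by at least
one dimension. -/
lemma IsQuotient.exists_radical_eq_bot {L : DiagData k ι} (hL : L.radical = ⊥) : ∀ (w : ℕ)
    (κ : Type) [Fintype κ] (L' : DiagData k κ), Module.finrank (ZMod 2) L'.radical = w →
      L.IsQuotient L' → L'.IsCover → ∃ (τ : Type) (_ : Fintype τ) (L'' : DiagData k τ),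
        L.IsQuotient L'' ∧ L''.IsCover ∧ L''.radical = ⊥ ∧
          Fintype.card τ ≤ Fintype.card κ + w := by
  intro w
  induction w using Nat.strong_induction_on with
  | _ w ih =>
    intro κ _ L' hw hq hc
    by_cases hr : L'.radical = ⊥
    · exact ⟨κ, inferInstance, L', hq, hc, hr, by omega⟩
    obtain ⟨a, ha, ha0⟩ := Submodule.exists_mem_ne_zero_of_ne_bot hr
    obtain ⟨e, he⟩ : ∃ e, L.chi e a ≠ 0 := by
      by_contra! h
      have := mem_radical.2 h
      rw [hL] at this
      exact ha0 ((Submodule.mem_bot _).1 this)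
    have hlt : (L'.adjoin L e).radical < L'.radical := by
      refine lt_of_le_of_ne (fun v hv => ?_) fun h => ?_
      · rw [mem_radical] at hv ⊢
        exact fun j => hv (some j)
      · rw [← h, mem_radical] at ha
        exact he (ha none)
    have hfr := Submodule.finrank_lt_finrank_of_lt hlt
    obtain ⟨τ, hτ, L'', h1, h2, h3, h4⟩ := ih _ (hw ▸ hfr) (Option κ) (L'.adjoin L e) rfl
      (hq.adjoin ha he) (fun v hv => (hc v hv).elim fun j hj => ⟨some j, hj⟩)
    refine ⟨τ, hτ, L'', h1, h2, h3, h4.trans ?_⟩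
    rw [Fintype.card_option]
    omega

/-- Every coordinate has no half translations along the radical or is the only one that
is moved by some element of the radical. -/
def IsSplit (L : DiagData k ι) : Prop :=
  ∀ j, (∀ w ∈ L.radical, L.alpha j w = 0) ∨
    ∃ w ∈ L.radical, L.alpha j w = 1 ∧ ∀ i, i ≠ j → L.alpha i w = 0

def reindex (L : DiagData k ι) (e : κ ≃ ι) : DiagData k κ where
  chi := L.chi ∘ e
  alpha := L.alpha ∘ e

lemma isQuotient_reindex (L : DiagData k ι) (e : κ ≃ ι) : L.IsQuotient (L.reindex e) :=
  ⟨{ toFun := fun x j => x (e j), map_zero' := rfl, map_add' := fun _ _ => rfl },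
    fun y => ⟨fun i => y (e.symm i), by ext; simp⟩, fun _ _ => rfl, fun _ _ hx j => hx (e j)⟩

lemma IsCover.reindex {L : DiagData k ι} (h : L.IsCover) (e : κ ≃ ι) : (L.reindex e).IsCover := by
  intro v hv
  obtain ⟨i, hi⟩ := h v hv
  exact ⟨e.symm i, by simpa [Covers, DiagData.reindex] using hi⟩

lemma radical_reindex (L : DiagData k ι) (e : κ ≃ ι) : (L.reindex e).radical = L.radical := by
  ext v
  rw [mem_radical, mem_radical]
  exact e.forall_congr_left.trans (by simp [reindex])

/-- If all characters vanish, the private points witness the second alternative of `IsSplit`;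
otherwise the radical is made zero and the first holds trivially. -/
theorem exists_quotient [Fintype ι] (L : DiagData k ι) (hk1 : 1 ≤ k) (hk4 : k ≤ 4)
    (hc : L.IsCover) (hr : L.radical = ⊥) :
    ∃ d ≤ vasquezValue k, ∃ L' : DiagData k (Fin d),
      L.IsQuotient L' ∧ L'.IsCover ∧ L'.IsSplit := by
  obtain ⟨κ, _, L', hq, hL'⟩ := L.exists_isReduced _ ι L rfl (.refl L) hc
  rcases hL'.card_add_finrank_le hk1 hk4 with ⟨h0, hcard⟩ | hcard
  · let e := (Fintype.equivFin κ).symm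
    refine ⟨_, hcard, L'.reindex e, hq.trans (L'.isQuotient_reindex e), hL'.isCover.reindex e, ?_⟩
    obtain ⟨p, hp⟩ := hL'.exists_isPrivate
    intro j
    refine Or.inr ⟨p (e j), ?_, hp.alpha_self _, fun i hi => ?_⟩
    · rw [radical_reindex, mem_radical]
      simp [h0]
    · exact hp.alpha_eq_zero_of_chi_eq_zero (h0 _) (fun h => hi (e.injective h))
  · obtain ⟨τ, _, L'', hq'', hc'', hr'', hle⟩ :=
      IsQuotient.exists_radical_eq_bot hr _ κ L' rfl hq hL'.isCover
    let e := (Fintype.equivFin τ).symm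
    refine ⟨_, hle.trans hcard, L''.reindex e, hq''.trans (L''.isQuotient_reindex e),
      hc''.reindex e, fun j => Or.inl fun w hw => ?_⟩
    rw [radical_reindex, hr'', Submodule.mem_bot] at hw
    rw [hw, map_zero]

end DiagData

/-! ### Affine isometries, translations and diagonal isometries -/

section EuclideanIsometries

variable {d : ℕ}

lemma linearPart_apply (g : EuclIsom d) (x : EuclideanSpace ℝ (Fin d)) :
    linearPart d g x = g x - g 0 := by
  have := g.map_vsub x 0
  rw [vsub_eq_sub, sub_zero] at this
  exact this

lemma euclIsom_apply (g : EuclIsom d) (x : EuclideanSpace ℝ (Fin d)) :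
    g x = linearPart d g x + g 0 := by
  rw [linearPart_apply, sub_add_cancel]

lemma euclIsom_eq_of_linearPart {g h : EuclIsom d} (h1 : linearPart d g = linearPart d h)
    (h2 : g 0 = h 0) : g = h := by
  ext1 x
  rw [euclIsom_apply g, euclIsom_apply h, h1, h2]

lemma eq_constVAdd_of_linearPart_eq_one {g : EuclIsom d} (h : linearPart d g = 1) :
    g = AffineIsometryEquiv.constVAdd ℝ (EuclideanSpace ℝ (Fin d)) (g 0) := by
  ext1 x
  rw [euclIsom_apply g x, h]
  exact add_comm _ _

lemma linearPart_constVAdd (v : EuclideanSpace ℝ (Fin d)) :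
    linearPart d (AffineIsometryEquiv.constVAdd ℝ (EuclideanSpace ℝ (Fin d)) v) = 1 := by
  ext1 x
  rw [linearPart_apply]
  simp

/-- The embedding of the translations into the isometry group. -/
noncomputable def translationHom (d : ℕ) :
    Multiplicative (EuclideanSpace ℝ (Fin d)) →* EuclIsom d :=
  MonoidHom.mk' (fun v => AffineIsometryEquiv.constVAdd ℝ _ v.toAdd) <| by
    intro v w
    ext1 u
    exact add_assoc v.toAdd w.toAdd u

lemma constVAdd_add (v w : EuclideanSpace ℝ (Fin d)) :
    AffineIsometryEquiv.constVAdd ℝ (EuclideanSpace ℝ (Fin d)) (v + w) =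
      AffineIsometryEquiv.constVAdd ℝ _ v * AffineIsometryEquiv.constVAdd ℝ _ w :=
  (translationHom d).map_mul (.ofAdd v) (.ofAdd w)

lemma constVAdd_zsmul (z : ℤ) (v : EuclideanSpace ℝ (Fin d)) :
    AffineIsometryEquiv.constVAdd ℝ (EuclideanSpace ℝ (Fin d)) (z • v) =
      AffineIsometryEquiv.constVAdd ℝ _ v ^ z :=
  (translationHom d).map_zpow (.ofAdd v) z

/-- The diagonal linear isometry with signs `(-1)^(a i)`. -/
noncomputable def signIsometry (a : Fin d → ZMod 2) :
    EuclideanSpace ℝ (Fin d) ≃ₗᵢ[ℝ] EuclideanSpace ℝ (Fin d) :=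
  LinearIsometryEquiv.piLpCongrRight 2 fun i =>
    if a i = 0 then LinearIsometryEquiv.refl ℝ ℝ else LinearIsometryEquiv.neg ℝ

lemma signIsometry_apply (a : Fin d → ZMod 2) (v : EuclideanSpace ℝ (Fin d)) (i : Fin d) :
    signIsometry a v i = DiagData.sgn (a i) * v i := by
  simp only [signIsometry, LinearIsometryEquiv.piLpCongrRight_apply, DiagData.sgn]
  split_ifs <;> simp

/-- The isometry `y ↦ (-1)^a y + t`. -/
noncomputable def diagIsometry (a : Fin d → ZMod 2) (t : EuclideanSpace ℝ (Fin d)) :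
    EuclIsom d :=
  AffineIsometryEquiv.constVAdd ℝ _ t * (signIsometry a).toAffineIsometryEquiv

lemma diagIsometry_apply (a : Fin d → ZMod 2) (t v : EuclideanSpace ℝ (Fin d)) :
    diagIsometry a t v = t + signIsometry a v := rfl

lemma diagIsometry_zero (a : Fin d → ZMod 2) (t : EuclideanSpace ℝ (Fin d)) :
    diagIsometry a t 0 = t := by
  rw [diagIsometry_apply, map_zero, add_zero]

lemma linearPart_diagIsometry (a : Fin d → ZMod 2) (t : EuclideanSpace ℝ (Fin d)) :
    linearPart d (diagIsometry a t) = signIsometry a := by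
  ext1 x
  rw [linearPart_apply, diagIsometry_zero, diagIsometry_apply, add_sub_cancel_left]

lemma signIsometry_eq_one_iff {a : Fin d → ZMod 2} : signIsometry a = 1 ↔ a = 0 := by
  constructor
  · intro h
    funext i
    have h1 := signIsometry_apply a (EuclideanSpace.single i 1) i
    rw [h] at h1
    by_contra hne
    simp only [DiagData.sgn, Pi.zero_apply] at h1 hne
    rw [if_neg hne] at h1
    norm_num at h1
  · rintro rfl
    ext v i
    rw [signIsometry_apply]
    simp [DiagData.sgn]

end EuclideanIsometries

/-! ### From families to Bieberbach groups of diagonal type -/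

/-- A surjection `q` of `P` onto `𝔽₂ᵏ` together with coordinates `x` that describe an action of `P`
by the isometries `y ↦ (-1)^(χ (q γ)) y + x γ / 2`, such that the elements of the kernel of `q`
yield all translations by integer vectors. -/
structure DiagModel (P : Type) [Group P] {k : ℕ} {ι : Type} (L : DiagData k ι) where
  q : P → BoolVec k
  x : P → ι → ℤ
  q_mul : ∀ γ δ, q (γ * δ) = q γ + q δ
  q_surjective : Function.Surjective q
  x_mul : ∀ γ δ i, x (γ * δ) i = x γ i + DiagData.sgn (L.chi i (q γ)) * x δ i
  parity : ∀ γ i, (x γ i : ZMod 2) = L.alpha i (q γ)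
  exists_translation : ∀ y : ι → ℤ, ∃ γ, q γ = 0 ∧ ∀ i, x γ i = 2 * y i

lemma DiagData.sgn_zero : DiagData.sgn 0 = 1 := rfl

lemma DiagData.sgn_add (a b : ZMod 2) :
    DiagData.sgn (a + b) = DiagData.sgn a * DiagData.sgn b := by
  revert a b; decide

namespace DiagModel

variable {P : Type} [Group P] {k d : ℕ} {ι κ : Type}

/-- A model for a family yields models for the quotients of the family. -/
lemma nonempty_of_isQuotient {L : DiagData k ι} {L' : DiagData k κ} (M : DiagModel P L)
    (h : L.IsQuotient L') : ∃ M' : DiagModel P L', M'.q = M.q := by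
  obtain ⟨F, hF, hs, hp⟩ := h
  refine ⟨⟨M.q, fun γ => F (M.x γ), M.q_mul, M.q_surjective, fun γ δ j => ?_,
    fun γ => hp _ _ (M.parity γ), fun y => ?_⟩, rfl⟩
  · have h1 : M.x (γ * δ) = M.x γ + fun i => DiagData.sgn (L.chi i (M.q γ)) * M.x δ i :=
      funext (M.x_mul γ δ)
    rw [h1, map_add, hs]
    rfl
  · obtain ⟨z, rfl⟩ := hF y
    obtain ⟨γ, h1, h2⟩ := M.exists_translation z
    refine ⟨γ, h1, fun j => ?_⟩
    have h3 : M.x γ = z + z := by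
      funext i; rw [h2, Pi.add_apply]; ring
    rw [h3, map_add, Pi.add_apply]
    ring

section

variable {L : DiagData k ι} (M : DiagModel P L)

lemma q_one : M.q 1 = 0 := by
  have := M.q_mul 1 1
  simpa using this

lemma x_one : M.x 1 = 0 := by
  funext i
  have := M.x_mul 1 1 i
  simpa [M.q_one, DiagData.sgn] using this

lemma x_pow {γ : P} {i : ι} (h : L.chi i (M.q γ) = 0) (m : ℕ) : M.x (γ ^ m) i = m * M.x γ i := by
  induction m with
  | zero => simp [M.x_one]
  | succ m ih =>
    rw [pow_succ', M.x_mul, h, DiagData.sgn_zero, ih]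
    push_cast
    ring

end

variable {L : DiagData k (Fin d)} (M : DiagModel P L)

/-- The action by isometries that a model describes. -/
noncomputable def toIsom : P →* EuclIsom d :=
  MonoidHom.mk' (fun γ => diagIsometry (fun i => L.chi i (M.q γ))
    (WithLp.toLp 2 fun i => (M.x γ i : ℝ) / 2)) <| by
    intro γ δ
    ext v i
    change _ = diagIsometry _ _ (diagIsometry _ _ v) i
    simp only [diagIsometry_apply, PiLp.add_apply, signIsometry_apply, M.x_mul, M.q_mul, map_add,
      DiagData.sgn_add]
    push_cast
    ring

lemma toIsom_apply (γ : P) : M.toIsom γ = diagIsometry (fun i => L.chi i (M.q γ))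
    (WithLp.toLp 2 fun i => (M.x γ i : ℝ) / 2) := rfl

lemma linearPart_toIsom (γ : P) :
    linearPart d (M.toIsom γ) = signIsometry fun i => L.chi i (M.q γ) := by
  rw [toIsom_apply, linearPart_diagIsometry]

lemma toIsom_zero (γ : P) (i : Fin d) : M.toIsom γ 0 i = (M.x γ i : ℝ) / 2 := by
  rw [toIsom_apply, diagIsometry_zero]

/-- If `q γ ≠ 0`, the covering coordinate has odd `x`. Thus the kernel lies over `q = 0`, which
later puts it inside the lattice. -/
lemma toIsom_eq_one_iff (hL : L.IsCover) {γ : P} :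
    M.toIsom γ = 1 ↔ M.q γ = 0 ∧ M.x γ = 0 := by
  constructor
  · intro h
    have hx : M.x γ = 0 := by
      funext i
      have := M.toIsom_zero γ i
      rw [h] at this
      simpa using this.symm
    refine ⟨?_, hx⟩
    by_contra hq
    obtain ⟨i, hi⟩ := hL _ hq
    have := M.parity γ i
    rw [hi.2, hx] at this
    simp at this
  · rintro ⟨hq, hx⟩
    apply euclIsom_eq_of_linearPart
    · rw [linearPart_toIsom, map_one, signIsometry_eq_one_iff]
      funext i
      simp [hq]
    · ext i
      rw [toIsom_zero, hx]
      simp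

lemma isCrystallographic_range : IsCrystallographic M.toIsom.range := by
  refine ⟨DiscreteTopology.of_forall_le_dist (r := 1 / 2) (by norm_num) ?_, ?_⟩
  · rintro ⟨_, g, ⟨γ, rfl⟩, rfl⟩ ⟨_, h, ⟨δ, rfl⟩, rfl⟩ hne
    rw [Subtype.dist_eq]
    by_cases hx : ∃ i, M.x γ i ≠ M.x δ i
    · obtain ⟨i, hi⟩ := hx
      refine le_trans ?_ (le_max_right _ _)
      rw [dist_eq_norm]
      refine le_trans ?_ (PiLp.norm_apply_le _ i)
      change _ ≤ ‖(M.toIsom γ 0 - M.toIsom δ 0) i‖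
      rw [PiLp.sub_apply, toIsom_zero, toIsom_zero, Real.norm_eq_abs, ← sub_div, abs_div]
      have h1 : (1 : ℝ) ≤ |(M.x γ i : ℝ) - M.x δ i| := by
        exact_mod_cast Int.one_le_abs (sub_ne_zero.2 hi)
      have h2 : |(2 : ℝ)| = 2 := by norm_num
      rw [h2]
      linarith
    · push Not at hx
      have hs : ∃ i, L.chi i (M.q γ) ≠ L.chi i (M.q δ) := by
        by_contra! h
        apply hne
        have : M.toIsom γ = M.toIsom δ := by
          rw [toIsom_apply, toIsom_apply]
          simp only [h, hx]
        exact Subtype.ext (congrArg (isomPair d) this)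
      obtain ⟨i, hi⟩ := hs
      refine le_trans ?_ (le_max_left _ _)
      rw [dist_eq_norm]
      have h1 := ContinuousLinearMap.le_opNorm
        ((isomPair d (M.toIsom γ)).1 - (isomPair d (M.toIsom δ)).1) (EuclideanSpace.single i 1)
      rw [PiLp.norm_single, norm_one, mul_one] at h1
      refine le_trans ?_ h1
      refine le_trans ?_ (PiLp.norm_apply_le _ i)
      change _ ≤ ‖(linearPart d (M.toIsom γ) (EuclideanSpace.single i 1) -
        linearPart d (M.toIsom δ) (EuclideanSpace.single i 1)) i‖
      rw [linearPart_toIsom, linearPart_toIsom, PiLp.sub_apply, signIsometry_apply,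
        signIsometry_apply]
      simp only [PiLp.single_apply, if_true, mul_one, DiagData.sgn]
      have key : ∀ a b : ZMod 2, a ≠ b →
          (1 / 2 : ℝ) ≤
            ‖((if a = 0 then 1 else -1 : ℤ) : ℝ) - ((if b = 0 then 1 else -1 : ℤ) : ℝ)‖ := by
        intro a b hab
        by_cases ha : a = 0
        · have hb : b ≠ 0 := fun h => hab (ha.trans h.symm)
          rw [if_pos ha, if_neg hb]
          norm_num
        · have hb : b = 0 := by
            by_contra h
            exact hab ((zmod_two_eq_one ha).trans (zmod_two_eq_one h).symm)
          rw [if_neg ha, if_pos hb]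
          norm_num
      exact key _ _ hi
  · refine ⟨WithLp.toLp 2 '' Set.pi Set.univ fun _ => Set.Icc 0 1,
      (isCompact_univ_pi fun _ => isCompact_Icc).image (PiLp.continuous_toLp 2 _), fun v => ?_⟩
    obtain ⟨γ, hq, hx⟩ := M.exists_translation fun i => -⌊v i⌋
    refine ⟨M.toIsom γ, ⟨γ, rfl⟩, ⟨fun i => Int.fract (v i), fun i _ =>
      ⟨Int.fract_nonneg _, (Int.fract_lt_one _).le⟩, ?_⟩⟩
    ext i
    rw [toIsom_apply, diagIsometry_apply, PiLp.add_apply, signIsometry_apply, hq, map_zero,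
      DiagData.sgn_zero]
    simp only [hx, Int.fract]
    push_cast
    ring

/-- On a coordinate with trivial sign `x` is additive on powers, so torsion forces `x = 0` there;
over a nonzero point the covering coordinate has odd `x`. -/
lemma isBieberbach_range (hL : L.IsCover) : IsBieberbach M.toIsom.range := by
  refine ⟨M.isCrystallographic_range, ?_⟩
  rintro _ ⟨γ, rfl⟩ m hm h
  rw [← map_pow, M.toIsom_eq_one_iff hL] at h
  have hmx : ∀ i, L.chi i (M.q γ) = 0 → M.x γ i = 0 := by
    intro i hi
    have h1 := M.x_pow hi m
    rw [h.2] at h1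
    have hm' : (m : ℤ) ≠ 0 := by exact_mod_cast hm.ne'
    simp only [Pi.zero_apply] at h1
    exact (mul_eq_zero.1 h1.symm).resolve_left hm'
  have hq : M.q γ = 0 := by
    by_contra hq
    obtain ⟨i, hi⟩ := hL _ hq
    have := M.parity γ i
    rw [hi.2, hmx i hi.1] at this
    simp at this
  rw [M.toIsom_eq_one_iff hL]
  exact ⟨hq, funext fun i => hmx i (by simp [hq])⟩

lemma toIsom_eq_constVAdd {γ : P} (h : M.q γ ∈ L.radical) : M.toIsom γ =
    AffineIsometryEquiv.constVAdd ℝ _ (WithLp.toLp 2 fun i => (M.x γ i : ℝ) / 2) := by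
  rw [DiagData.mem_radical] at h
  rw [eq_constVAdd_of_linearPart_eq_one (g := M.toIsom γ)]
  · rw [toIsom_apply, diagIsometry_zero]
  · rw [linearPart_toIsom, signIsometry_eq_one_iff]
    exact funext h

lemma hasDiagonalHolonomy_range (hs : L.IsSplit) : HasDiagonalHolonomy M.toIsom.range := by
  classical
  -- Elements over the radical act as translations, so half steps can occur. `IsSplit` says that a
  -- coordinate with half steps has one that leaves the other coordinates integral.
  let c : Fin d → ℝ := fun j => if ∀ w ∈ L.radical, L.alpha j w = 0 then 1 else 1 / 2
  have hc : ∀ j, c j ≠ 0 := by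
    intro j
    simp only [c]
    split_ifs <;> norm_num
  let b := (EuclideanSpace.basisFun (Fin d) ℝ).toBasis.isUnitSMul (w := c)
    fun j => (hc j).isUnit
  have hb : ∀ j, b j = EuclideanSpace.single j (c j) := by
    intro j
    ext i
    simp [b, Module.Basis.isUnitSMul_apply]
  have hsum : ∀ v : EuclideanSpace ℝ (Fin d), v = ∑ j, (v j / c j) • b j := by
    intro v
    ext i
    simp [hb, hc, Pi.single_apply]
  refine ⟨b, fun v => ⟨?_, fun hv => ?_⟩, ?_⟩
  · rintro ⟨γ, hγ⟩
    have hrad : M.q γ ∈ L.radical := by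
      rw [DiagData.mem_radical]
      have := M.linearPart_toIsom γ
      rw [hγ, linearPart_constVAdd] at this
      exact congrFun (signIsometry_eq_one_iff.1 this.symm)
    have hvx : ∀ i, v i = (M.x γ i : ℝ) / 2 := by
      intro i
      rw [← toIsom_zero, hγ]
      simp
    rw [hsum v]
    refine Submodule.sum_mem _ fun j _ => ?_
    have hint : ∃ z : ℤ, v j / c j = z := by
      by_cases h : ∀ w ∈ L.radical, L.alpha j w = 0
      · have hev := M.parity γ j
        rw [h _ hrad, ZMod.intCast_zmod_eq_zero_iff_dvd] at hev
        obtain ⟨z, hz⟩ := hev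
        refine ⟨z, ?_⟩
        simp only [c, if_pos h, hvx, hz]
        push_cast
        ring
      · refine ⟨M.x γ j, ?_⟩
        simp only [c, if_neg h, hvx]
        ring
    obtain ⟨z, hz⟩ := hint
    rw [hz, Int.cast_smul_eq_zsmul]
    exact Submodule.smul_mem _ _ (Submodule.subset_span ⟨j, rfl⟩)
  · induction hv using Submodule.span_induction with
    | mem v hv =>
      obtain ⟨j, rfl⟩ := hv
      rw [hb]
      by_cases h : ∀ w ∈ L.radical, L.alpha j w = 0
      · obtain ⟨γ, hq, hx⟩ := M.exists_translation (Pi.single j 1)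
        refine ⟨γ, ?_⟩
        rw [M.toIsom_eq_constVAdd (hq ▸ Submodule.zero_mem _)]
        congr 1
        ext i
        simp only [hx, c, if_pos h, Pi.single_apply, PiLp.single_apply]
        split_ifs <;> simp
      · obtain ⟨w, hw, hj, hne⟩ := (hs j).resolve_left h
        obtain ⟨γ, rfl⟩ := M.q_surjective w
        have hpar : ∀ i, ∃ z : ℤ, M.x γ i = (if i = j then 1 else 0) + 2 * z := by
          intro i
          have hev : ((M.x γ i - if i = j then 1 else 0 : ℤ) : ZMod 2) = 0 := by
            rw [Int.cast_sub, M.parity]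
            by_cases hi : i = j
            · subst hi; simp [hj]
            · simp [hi, hne i hi]
          rw [ZMod.intCast_zmod_eq_zero_iff_dvd] at hev
          obtain ⟨z, hz⟩ := hev
          exact ⟨z, by push_cast at hz; omega⟩
        choose z hz using hpar
        obtain ⟨δ, hq, hx⟩ := M.exists_translation fun i => -z i
        refine ⟨δ * γ, ?_⟩
        rw [M.toIsom_eq_constVAdd (by rw [M.q_mul, hq, zero_add]; exact hw)]
        congr 1
        ext i
        simp only [M.x_mul, hq, map_zero, DiagData.sgn_zero, hx, hz, c, if_neg h,
          PiLp.single_apply]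
        split_ifs <;> · push_cast; ring
    | zero =>
      rw [AffineIsometryEquiv.constVAdd_zero]
      exact Subgroup.one_mem _
    | add v w _ _ hv hw =>
      rw [constVAdd_add]
      exact Subgroup.mul_mem _ hv hw
    | smul z v _ hv =>
      rw [constVAdd_zsmul]
      exact Subgroup.zpow_mem _ hv z
  · rintro _ ⟨γ, rfl⟩ i
    rw [linearPart_toIsom, hb]
    by_cases h : L.chi i (M.q γ) = 0
    · left
      ext j
      rw [signIsometry_apply]
      by_cases hj : j = i
      · subst hj; simp [h, DiagData.sgn]
      · simp [hj]
    · right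
      ext j
      rw [signIsometry_apply]
      by_cases hj : j = i
      · subst hj; simp [h, DiagData.sgn]
      · simp [hj]

lemma isDiagonalType_range (hs : L.IsSplit) : IsDiagonalType M.toIsom.range :=
  ⟨_, M.isCrystallographic_range, M.hasDiagonalHolonomy_range hs, ⟨MulEquiv.refl _⟩⟩

end DiagModel

/-! ### An algebraic description of the lattice, invariant under abstract isomorphism -/

lemma mem_latticeSubgroup {n : ℕ} {Γ : Subgroup (EuclIsom n)} {γ : Γ} :
    γ ∈ latticeSubgroup Γ ↔ linearPart n (γ : EuclIsom n) = 1 := Iff.rfl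

section Translations

variable {n : ℕ} {Γ : Subgroup (EuclIsom n)}

/-- The translations of a cocompact group with finite holonomy span the whole space. -/
lemma exists_translation_apply_ne_zero
    (hK : ∃ K : Set (EuclideanSpace ℝ (Fin n)), IsCompact K ∧ ∀ x, ∃ γ ∈ Γ, γ x ∈ K)
    (hfin : Finite (holonomyGroup Γ)) {g : EuclideanSpace ℝ (Fin n) →L[ℝ] ℝ} (hg : g ≠ 0) :
    ∃ v, AffineIsometryEquiv.constVAdd ℝ (EuclideanSpace ℝ (Fin n)) v ∈ Γ ∧ g v ≠ 0 := by
  by_contra! hno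
  obtain ⟨K, hKc, hK⟩ := hK
  have hlift : ∀ A : holonomyGroup Γ, ∃ γ ∈ Γ, linearPart n γ = A := fun A => A.2
  choose σ hσ hσA using hlift
  -- A real vector space is not a finite union of proper subspaces.
  have hx0 : ∃ x, ∀ A : holonomyGroup Γ, g (A.1 x) ≠ 0 := by
    by_contra! h
    obtain ⟨A, hA⟩ := Subspace.exists_eq_top_of_iUnion_eq_univ
      (p := fun A : holonomyGroup Γ =>
        LinearMap.ker (g.toLinearMap ∘ₗ A.1.toLinearEquiv.toLinearMap)) <| by
      rw [Set.eq_univ_iff_forall]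
      intro x
      obtain ⟨A, hA⟩ := h x
      exact Set.mem_iUnion.2 ⟨A, hA⟩
    apply hg
    ext v
    have : A.1.symm v ∈
        LinearMap.ker (g.toLinearMap ∘ₗ A.1.toLinearEquiv.toLinearMap) := by
      rw [hA]; trivial
    simpa using this
  obtain ⟨x, hx⟩ := hx0
  obtain ⟨C, hC⟩ := (hKc.image g.continuous).isBounded.exists_norm_le
  -- If `g` kills all translations, `g (γ y)` depends only on `y` and the linear part of `γ`. The
  -- multiple `(t + 1) • x` is so long that no image of it can lie in `K`.
  obtain ⟨t, ht⟩ := Set.Finite.bddAbove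
    (Set.finite_range fun A : holonomyGroup Γ => (C + ‖g (σ A 0)‖) / ‖g (A.1 x)‖)
  obtain ⟨γ, hγ, hγK⟩ := hK ((t + 1) • x)
  set A : holonomyGroup Γ := ⟨linearPart n γ, γ, hγ, rfl⟩ with hA
  have hlin : linearPart n (γ * (σ A)⁻¹) = 1 := by
    rw [map_mul, map_inv, hσA, hA, mul_inv_cancel]
  have htr := eq_constVAdd_of_linearPart_eq_one hlin
  have hmem : γ * (σ A)⁻¹ ∈ Γ := Γ.mul_mem hγ (Γ.inv_mem (hσ A))
  have hv := hno ((γ * (σ A)⁻¹) 0) (htr ▸ hmem)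
  have hγ' : γ ((t + 1) • x) = (γ * (σ A)⁻¹) 0 + ((t + 1) • A.1 x + σ A 0) := by
    have h1 : γ = (γ * (σ A)⁻¹) * σ A := by group
    have h2 : (γ * (σ A)⁻¹ * σ A) ((t + 1) • x) = (γ * (σ A)⁻¹) (σ A ((t + 1) • x)) := rfl
    rw [congrArg (fun f : EuclIsom n => f ((t + 1) • x)) h1, h2, euclIsom_apply (σ A), hσA,
      map_smul]
    exact congrArg (fun f : EuclIsom n => f ((t + 1) • A.1 x + σ A 0)) htr
  have hb := hC _ ⟨_, hγK, rfl⟩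
  rw [hγ', map_add, hv, zero_add, map_add, map_smul, smul_eq_mul] at hb
  have h1 : ‖(t + 1) * g (A.1 x)‖ ≤ C + ‖g (σ A 0)‖ := by
    have := norm_sub_le ((t + 1) * g (A.1 x) + g (σ A 0)) (g (σ A 0))
    rw [add_sub_cancel_right] at this
    linarith
  have h2 : (C + ‖g (σ A 0)‖) / ‖g (A.1 x)‖ ≤ t := ht ⟨A, rfl⟩
  have hpos : 0 < ‖g (A.1 x)‖ := norm_pos_iff.2 (hx A)
  rw [div_le_iff₀ hpos] at h2
  rw [norm_mul, Real.norm_eq_abs] at h1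
  have h3 := mul_le_mul_of_nonneg_right (le_abs_self (t + 1)) hpos.le
  linarith

lemma conj_apply_zero {γ δ : EuclIsom n} (h : linearPart n γ = 1) :
    δ * γ * δ⁻¹ =
      AffineIsometryEquiv.constVAdd ℝ (EuclideanSpace ℝ (Fin n)) (linearPart n δ (γ 0)) := by
  have h1 : linearPart n (δ * γ * δ⁻¹) = 1 := by
    rw [map_mul, map_mul, h, mul_one, map_inv, mul_inv_cancel]
  rw [eq_constVAdd_of_linearPart_eq_one h1]
  congr 1
  change δ (γ (δ⁻¹ 0)) = _
  rw [eq_constVAdd_of_linearPart_eq_one h]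
  change δ (γ 0 + δ⁻¹ 0) = linearPart n δ (γ 0 + 0)
  rw [euclIsom_apply δ, map_add, add_zero, add_assoc, ← euclIsom_apply δ]
  have : δ (δ⁻¹ 0) = 0 := congrArg (fun f : EuclIsom n => f 0) (mul_inv_cancel δ)
  rw [this, add_zero]

/-- In a cocompact group with finite holonomy the lattice subgroup consists of the elements
with finitely many conjugates. -/
lemma mem_latticeSubgroup_iff_finite_conj
    (hK : ∃ K : Set (EuclideanSpace ℝ (Fin n)), IsCompact K ∧ ∀ x, ∃ γ ∈ Γ, γ x ∈ K)
    (hfin : Finite (holonomyGroup Γ)) (γ : Γ) :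
    γ ∈ latticeSubgroup Γ ↔ (Set.range fun δ : Γ => δ * γ * δ⁻¹).Finite := by
  constructor
  · intro h
    refine Set.Finite.of_finite_image (f := ((↑) : Γ → EuclIsom n)) ?_ Subtype.val_injective.injOn
    refine Set.Finite.subset (Set.finite_range fun A : holonomyGroup Γ =>
      AffineIsometryEquiv.constVAdd ℝ (EuclideanSpace ℝ (Fin n)) (A.1 ((γ : EuclIsom n) 0))) ?_
    rintro _ ⟨_, ⟨δ, rfl⟩, rfl⟩
    exact ⟨⟨linearPart n δ, δ, δ.2, rfl⟩, (conj_apply_zero (mem_latticeSubgroup.1 h)).symm⟩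
  · intro h
    rw [mem_latticeSubgroup]
    by_contra hne
    obtain ⟨x, hx⟩ : ∃ x, linearPart n (γ : EuclIsom n) x - x ≠ 0 := by
      by_contra! h
      apply hne
      ext1 x
      exact sub_eq_zero.1 (h x)
    set A := linearPart n (γ : EuclIsom n) with hA
    let T : EuclideanSpace ℝ (Fin n) →L[ℝ] EuclideanSpace ℝ (Fin n) :=
      (A.toContinuousLinearEquiv : EuclideanSpace ℝ (Fin n) →L[ℝ] EuclideanSpace ℝ (Fin n)) -
        ContinuousLinearMap.id ℝ _
    -- A translation with `g v ≠ 0` is not fixed by `A`, so conjugating by its powers gives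
    -- infinitely many elements.
    let g : EuclideanSpace ℝ (Fin n) →L[ℝ] ℝ := (innerSL ℝ (A x - x)).comp T
    have hg : g ≠ 0 := by
      intro h0
      have : g x = 0 := by rw [h0]; rfl
      exact hx ((inner_self_eq_zero (𝕜 := ℝ)).1 this)
    obtain ⟨v, hv, hgv⟩ := exists_translation_apply_ne_zero hK hfin hg
    have hTv : A v - v ≠ 0 := by
      intro h0
      apply hgv
      change inner ℝ (A x - x) (A v - v) = 0
      rw [h0, inner_zero_right]
    let τ : Γ := ⟨_, hv⟩
    have hval : ∀ m : ℕ, ((τ ^ m * γ * (τ ^ m)⁻¹ : Γ) : EuclIsom n) 0 =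
        (γ : EuclIsom n) 0 - (m : ℝ) • (A v - v) := by
      intro m
      have h1 : ((τ ^ m : Γ) : EuclIsom n) =
          AffineIsometryEquiv.constVAdd ℝ (EuclideanSpace ℝ (Fin n)) ((m : ℤ) • v) := by
        rw [constVAdd_zsmul]
        simp [τ]
      have h2 : (((τ ^ m)⁻¹ : Γ) : EuclIsom n) =
          AffineIsometryEquiv.constVAdd ℝ (EuclideanSpace ℝ (Fin n)) (-(m : ℤ) • v) := by
        rw [constVAdd_zsmul]
        simp [τ]
      have h3 : ((τ ^ m * γ * (τ ^ m)⁻¹ : Γ) : EuclIsom n) 0 =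
          ((τ ^ m : Γ) : EuclIsom n) ((γ : EuclIsom n) ((((τ ^ m)⁻¹ : Γ) : EuclIsom n) 0)) := rfl
      rw [h3, h1, h2]
      change (m : ℤ) • v + (γ : EuclIsom n) (-(m : ℤ) • v + 0) = _
      rw [euclIsom_apply (γ : EuclIsom n), ← hA, add_zero, map_zsmul, ← Int.cast_smul_eq_zsmul ℝ,
        ← Int.cast_smul_eq_zsmul ℝ, smul_sub]
      push_cast
      rw [neg_smul]
      abel
    have hinj : Function.Injective fun m : ℕ => τ ^ m * γ * (τ ^ m)⁻¹ := by
      intro m m' hmm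
      have h1 := hval m
      have hmm' : τ ^ m * γ * (τ ^ m)⁻¹ = τ ^ m' * γ * (τ ^ m')⁻¹ := hmm
      rw [hmm', hval m', sub_right_inj, ← sub_eq_zero, ← sub_smul, smul_eq_zero] at h1
      have := h1.resolve_right hTv
      exact_mod_cast (sub_eq_zero.1 this).symm
    refine Set.infinite_range_of_injective hinj (h.subset ?_)
    rintro _ ⟨m, rfl⟩
    exact ⟨τ ^ m, rfl⟩

lemma finite_holonomyGroup_of_basis {b : Module.Basis (Fin n) ℝ (EuclideanSpace ℝ (Fin n))}
    (hb : ∀ γ ∈ Γ, ∀ i, linearPart n γ (b i) = b i ∨ linearPart n γ (b i) = -b i) :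
    Finite (holonomyGroup Γ) := by
  let S : Set (EuclideanSpace ℝ (Fin n)) := (Set.range b) ∪ (Set.range fun i => -b i)
  have hS : Finite S := ((Set.finite_range _).union (Set.finite_range _)).to_subtype
  refine Finite.of_injective (β := Fin n → S) (fun A i => ⟨A.1 (b i), ?_⟩) ?_
  · obtain ⟨γ, hγ, hA⟩ := A.2
    rw [← hA]
    rcases hb γ hγ i with h | h
    · exact Or.inl ⟨i, h.symm⟩
    · exact Or.inr ⟨i, h.symm⟩
  · intro A B h
    apply Subtype.ext
    have : A.1.toLinearEquiv.toLinearMap = B.1.toLinearEquiv.toLinearMap :=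
      b.ext fun i => congrArg Subtype.val (congrFun h i)
    ext1 x
    exact LinearMap.congr_fun this x

/-- An isomorphism of cocompact groups with finite holonomy preserves the lattice subgroups. -/
lemma latticeSubgroup_mulEquiv {m : ℕ} {Γ' : Subgroup (EuclIsom m)} (hΓ : IsCrystallographic Γ)
    (hΓ' : IsCrystallographic Γ') (hfin : Finite (holonomyGroup Γ))
    (hfin' : Finite (holonomyGroup Γ')) (φ : Γ ≃* Γ') (γ : Γ) :
    φ γ ∈ latticeSubgroup Γ' ↔ γ ∈ latticeSubgroup Γ := by
  rw [mem_latticeSubgroup_iff_finite_conj hΓ.cocompact hfin,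
    mem_latticeSubgroup_iff_finite_conj hΓ'.cocompact hfin',
    ← Set.finite_image_iff (f := φ) φ.injective.injOn, ← Set.range_comp]
  have : (Set.range fun δ : Γ' => δ * φ γ * δ⁻¹) = Set.range (φ ∘ fun δ : Γ => δ * γ * δ⁻¹) := by
    rw [← φ.surjective.range_comp]
    congr 1
    funext δ
    simp
  rw [this]

end Translations

/-! ### From Bieberbach groups to families, and the upper bound -/

open DiagData in
/-- The origin of an affine action on the line by `y ↦ ± y + a` can be chosen such that the
translation parts become half integers, if the squares act by integral translations. -/
lemma exists_half_integral {P : Type} [Group P] {ε : P → ZMod 2} {a : P → ℝ}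
    (hε : ∀ γ δ, ε (γ * δ) = ε γ + ε δ) (ha : ∀ γ δ, a (γ * δ) = a γ + sgn (ε γ) * a δ)
    (hsq : ∀ γ, ∃ z : ℤ, a (γ * γ) = z) :
    ∃ (s : ℝ) (x : P → ℤ), ∀ γ, (x γ : ℝ) = 2 * (a γ + (sgn (ε γ) - 1) * s) := by
  suffices h : ∃ s : ℝ, ∀ γ, ∃ z : ℤ, (z : ℝ) = 2 * (a γ + (sgn (ε γ) - 1) * s) by
    obtain ⟨s, hs⟩ := h
    choose x hx using hs
    exact ⟨s, x, hx⟩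
  have heven : ∀ γ, ε γ = 0 → ∃ z : ℤ, (z : ℝ) = 2 * a γ := by
    intro γ hγ
    obtain ⟨z, hz⟩ := hsq γ
    refine ⟨z, ?_⟩
    rw [← hz, ha, hγ, sgn_zero]
    push_cast
    ring
  have hone : sgn 1 = -1 := rfl
  by_cases h : ∃ δ, ε δ = 1
  · obtain ⟨δ, hδ⟩ := h
    -- The fixed point of the reflection `δ`. For any other reflection `γ` the new translation part
    -- is that of `γ * δ`, which preserves orientation.
    refine ⟨a δ / 2, fun γ => ?_⟩
    by_cases hγ : ε γ = 0
    · obtain ⟨z, hz⟩ := heven γ hγ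
      refine ⟨z, ?_⟩
      rw [hz, hγ, sgn_zero]
      push_cast
      ring
    · have hγ := zmod_two_eq_one hγ
      obtain ⟨z, hz⟩ := heven (γ * δ) (by rw [hε, hγ, hδ]; rfl)
      refine ⟨z, ?_⟩
      rw [hz, ha, hγ, hone]
      push_cast
      ring
  · push Not at h
    refine ⟨0, fun γ => ?_⟩
    have hγ : ε γ = 0 := by
      by_contra hne
      exact h γ (zmod_two_eq_one hne)
    obtain ⟨z, hz⟩ := heven γ hγ
    exact ⟨z, by rw [hz, mul_zero, add_zero]⟩

lemma exists_dual_factorization {P : Type} [Group P] {k : ℕ} {q : P → BoolVec k} {ε : P → ZMod 2}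
    (hq : ∀ γ δ, q (γ * δ) = q γ + q δ) (hs : Function.Surjective q)
    (hε : ∀ γ δ, ε (γ * δ) = ε γ + ε δ) (h0 : ∀ γ, q γ = 0 → ε γ = 0) :
    ∃ f : BoolDual k, ∀ γ, f (q γ) = ε γ := by
  have hwd : ∀ γ δ, q γ = q δ → ε γ = ε δ := by
    intro γ δ h
    have h1 := h0 (γ * δ) (by rw [hq, h, boolVec_add_self])
    rw [hε] at h1
    exact CharTwo.add_eq_zero.1 h1
  choose σ hσ using hs
  refine ⟨(AddMonoidHom.mk' (fun v => ε (σ v)) fun v w => ?_).toZModLinearMap 2, fun γ => ?_⟩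
  · rw [← hε]
    apply hwd
    rw [hσ, hq, hσ, hσ]
  · exact hwd _ _ (hσ _)

open DiagData in
lemma exists_diagModel {n k : ℕ} {Γ : Subgroup (EuclIsom n)} (hd : HasDiagonalHolonomy Γ)
    (htf : ∀ γ ∈ Γ, ∀ m : ℕ, 0 < m → γ ^ m = 1 → γ = 1) {q : Γ → BoolVec k}
    (hq : ∀ γ δ, q (γ * δ) = q γ + q δ) (hs : Function.Surjective q)
    (hker : ∀ γ, q γ = 0 ↔ γ ∈ latticeSubgroup Γ) :
    ∃ (L : DiagData k (Fin n)) (M : DiagModel Γ L), M.q = q ∧ L.IsCover ∧ L.radical = ⊥ := by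
  classical
  obtain ⟨b, hspan, hb⟩ := hd
  let ε : Fin n → Γ → ZMod 2 := fun i γ =>
    if linearPart n (γ : EuclIsom n) (b i) = b i then 0 else 1
  have hne : ∀ i, b i ≠ -b i := by
    intro i h
    have h1 := eq_neg_iff_add_eq_zero.1 h
    rw [← two_smul ℝ, smul_eq_zero] at h1
    exact b.ne_zero i (h1.resolve_left two_ne_zero)
  have hbε : ∀ (γ : Γ) i, linearPart n (γ : EuclIsom n) (b i) = (sgn (ε i γ) : ℝ) • b i := by
    intro γ i
    by_cases h : linearPart n (γ : EuclIsom n) (b i) = b i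
    · simp [ε, h, sgn]
    · simp only [ε, if_neg h, sgn]
      rw [(hb γ γ.2 i).resolve_left h]
      simp
  have hεsgn : ∀ i (γ : Γ) (e : ZMod 2),
      linearPart n (γ : EuclIsom n) (b i) = (sgn e : ℝ) • b i → ε i γ = e := by
    intro i γ e h
    by_cases he : e = 0
    · subst he
      simp only [sgn_zero, Int.cast_one, one_smul] at h
      simp [ε, h]
    · have he1 := zmod_two_eq_one he
      subst he1
      have h1 : (sgn 1 : ℝ) = -1 := by norm_num [sgn]
      rw [h1, neg_one_smul] at h
      simp only [ε]
      rw [if_neg]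
      rw [h]
      exact (hne i).symm
  have hεmul : ∀ i γ δ, ε i (γ * δ) = ε i γ + ε i δ := by
    intro i γ δ
    apply hεsgn
    have h1 : linearPart n ((γ * δ : Γ) : EuclIsom n) (b i) =
        linearPart n (γ : EuclIsom n) (linearPart n (δ : EuclIsom n) (b i)) := rfl
    rw [h1, hbε δ, map_smul, hbε γ, smul_smul, sgn_add]
    push_cast
    rw [mul_comm]
  have hrepr : ∀ (γ : Γ) v i, b.repr (linearPart n (γ : EuclIsom n) v) i =
      sgn (ε i γ) * b.repr v i := by
    intro γ v i
    conv_lhs => rw [← b.sum_repr v]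
    simp only [map_sum, map_smul, hbε]
    simp [Finsupp.single_apply, mul_comm]
  let a : Fin n → Γ → ℝ := fun i γ => b.repr ((γ : EuclIsom n) 0) i
  have hamul : ∀ i γ δ, a i (γ * δ) = a i γ + sgn (ε i γ) * a i δ := by
    intro i γ δ
    have h1 : ((γ * δ : Γ) : EuclIsom n) 0 = (γ : EuclIsom n) ((δ : EuclIsom n) 0) := rfl
    simp only [a]
    rw [h1, euclIsom_apply (γ : EuclIsom n), map_add, Finsupp.add_apply, hrepr, add_comm]
  have hlatε : ∀ i γ, q γ = 0 → ε i γ = 0 := by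
    intro i γ h
    have := mem_latticeSubgroup.1 ((hker γ).1 h)
    simp [ε, this]
  have hlata : ∀ i γ, q γ = 0 → ∃ z : ℤ, a i γ = z := by
    intro i γ h
    have h1 := eq_constVAdd_of_linearPart_eq_one (mem_latticeSubgroup.1 ((hker γ).1 h))
    have h2 := (hspan ((γ : EuclIsom n) 0)).1 (h1 ▸ γ.2)
    obtain ⟨z, hz⟩ := (b.mem_span_iff_repr_mem ℤ _).1 h2 i
    exact ⟨z, hz.symm⟩
  have hsq : ∀ i γ, ∃ z : ℤ, a i (γ * γ) = z := fun i γ =>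
    hlata i _ (by rw [hq, boolVec_add_self])
  choose s x hx using fun i => exists_half_integral (hεmul i) (hamul i) (hsq i)
  have hxmul : ∀ i γ δ, x i (γ * δ) = x i γ + sgn (ε i γ) * x i δ := by
    intro i γ δ
    have : (x i (γ * δ) : ℝ) = x i γ + sgn (ε i γ) * x i δ := by
      rw [hx, hx, hx, hamul, hεmul, sgn_add]
      push_cast
      ring
    exact_mod_cast this
  have hxlat : ∀ i γ, q γ = 0 → (x i γ : ℝ) = 2 * a i γ := by
    intro i γ h
    rw [hx, hlatε i γ h, sgn_zero]
    push_cast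
    ring
  choose χ hχ using fun i => exists_dual_factorization hq hs (hεmul i) (hlatε i)
  have hsgn : ∀ e : ZMod 2, ((sgn e : ℤ) : ZMod 2) = 1 := by decide
  choose α hα using fun i => exists_dual_factorization (ε := fun γ => (x i γ : ZMod 2)) hq hs
    (fun γ δ => by rw [hxmul]; push_cast; rw [hsgn, one_mul]) (fun γ h => by
      obtain ⟨z, hz⟩ := hlata i γ h
      have h1 := hxlat i γ h
      rw [hz] at h1
      have h2 : x i γ = 2 * z := by exact_mod_cast h1
      rw [h2, ZMod.intCast_zmod_eq_zero_iff_dvd]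
      exact ⟨z, rfl⟩)
  have htrans : ∀ y : Fin n → ℤ, ∃ γ : Γ, q γ = 0 ∧ ∀ i, x i γ = 2 * y i := by
    intro y
    have hmem : ∑ i, (y i) • b i ∈ Submodule.span ℤ (Set.range b) :=
      Submodule.sum_mem _ fun i _ => Submodule.smul_mem _ _ (Submodule.subset_span ⟨i, rfl⟩)
    let γ : Γ := ⟨_, (hspan _).2 hmem⟩
    have hγ : q γ = 0 := (hker γ).2 (mem_latticeSubgroup.2 (linearPart_constVAdd _))
    refine ⟨γ, hγ, fun i => ?_⟩
    have h1 := hxlat i γ hγ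
    have h2 : a i γ = y i := by
      have h3 : (γ : EuclIsom n) 0 = ∑ i, (y i : ℝ) • b i := by
        simp only [Int.cast_smul_eq_zsmul]
        exact add_zero _
      simp only [a]
      rw [h3, b.repr_sum_self]
    rw [h2] at h1
    exact_mod_cast h1
  let L : DiagData k (Fin n) := ⟨χ, α⟩
  let M : DiagModel Γ L :=
    { q := q
      x := fun γ i => x i γ
      q_mul := hq
      q_surjective := hs
      x_mul := fun γ δ i => by rw [hxmul, ← hχ]
      parity := fun γ i => (hα i γ).symm
      exists_translation := htrans }
  have hinj : ∀ γ, q γ = 0 → (∀ i, x i γ = 0) → γ = 1 := by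
    intro γ h h0
    have h1 := eq_constVAdd_of_linearPart_eq_one (mem_latticeSubgroup.1 ((hker γ).1 h))
    have h2 : (γ : EuclIsom n) 0 = 0 := by
      apply b.repr.injective
      ext i
      have h3 := hxlat i γ h
      rw [h0] at h3
      simp only [a] at h3
      rw [show b.repr 0 i = 0 by simp]
      push_cast at h3
      linarith
    apply Subtype.ext
    rw [h1, h2, AffineIsometryEquiv.constVAdd_zero]
    rfl
  refine ⟨L, M, rfl, fun v hv => ?_, ?_⟩
  -- Over an uncovered `v` a translation makes `x` vanish wherever the sign is trivial. The
  -- resulting element has order two.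
  · by_contra! hno
    obtain ⟨γ, rfl⟩ := hs v
    have hev : ∀ i, ∃ z : ℤ, χ i (q γ) = 0 → x i γ = 2 * z := by
      intro i
      by_cases h : χ i (q γ) = 0
      · have h1 : α i (q γ) = 0 := by
          by_contra h1
          exact hno i ⟨h, zmod_two_eq_one h1⟩
        rw [hα, ZMod.intCast_zmod_eq_zero_iff_dvd] at h1
        obtain ⟨z, hz⟩ := h1
        exact ⟨z, fun _ => hz⟩
      · exact ⟨0, fun h' => absurd h' h⟩
    choose z hz using hev
    obtain ⟨τ, hτ, hτx⟩ := htrans fun i => -z i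
    have hqτ : q (τ * γ) = q γ := by rw [hq, hτ, zero_add]
    have hsq1 : (τ * γ) * (τ * γ) = 1 := by
      refine hinj _ (by rw [hq, boolVec_add_self]) fun i => ?_
      rw [hxmul i (τ * γ), ← hχ, hqτ]
      by_cases h : χ i (q γ) = 0
      · rw [hxmul, hτx, hz i h, hlatε i τ hτ, sgn_zero, h, sgn_zero]
        ring
      · rw [zmod_two_eq_one h, show sgn 1 = -1 from rfl]
        ring
    have h1 := htf _ (τ * γ).2 2 two_pos (by
      rw [pow_two]
      exact congrArg Subtype.val hsq1)
    have h2 : τ * γ = 1 := Subtype.ext h1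
    apply hv
    rw [← hqτ, h2]
    have := hq 1 1
    simpa using this
  · rw [eq_bot_iff]
    intro v hv
    obtain ⟨γ, rfl⟩ := hs v
    rw [mem_radical] at hv
    rw [Submodule.mem_bot, hker, mem_latticeSubgroup]
    have h1 : (linearPart n (γ : EuclIsom n)).toLinearEquiv.toLinearMap = LinearMap.id := by
      refine b.ext fun i => ?_
      change linearPart n (γ : EuclIsom n) (b i) = b i
      rw [hbε, ← hχ, hv i, sgn_zero]
      simp
    ext1 u
    exact LinearMap.congr_fun h1 u

/-- Only an isomorphic copy `Γ'` need be diagonal, so the holonomy map is transported to `Γ'`;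
`latticeSubgroup_mulEquiv` identifies its kernel with the lattice there. `N` is the kernel of the
action given by the quotient family. -/
theorem diagonalVasquezBound_vasquezValue {k : ℕ} (hk1 : 1 ≤ k) (hk4 : k ≤ 4) :
    DiagonalVasquezBound (C2Pow k) (DiagData.vasquezValue k) := by
  rintro n Γ hΓ ⟨Γ', hΓ', hd, ⟨φ⟩⟩ ⟨ψ⟩
  have hfin : Finite (holonomyGroup Γ) := Finite.of_equiv _ ψ.symm.toEquiv
  have hfin' : Finite (holonomyGroup Γ') := by
    obtain ⟨b, -, hb⟩ := hd
    exact finite_holonomyGroup_of_basis hb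
  have hlat := latticeSubgroup_mulEquiv hΓ.toIsCrystallographic hΓ' hfin hfin' φ
  let π : Γ →* holonomyGroup Γ := (linearPart n).subgroupMap Γ
  let q : Γ' → BoolVec k := fun γ i => (ψ (π (φ.symm γ)) i).toAdd
  have hker : ∀ γ, q γ = 0 ↔ γ ∈ latticeSubgroup Γ' := by
    intro γ
    obtain ⟨γ, rfl⟩ := φ.surjective γ
    rw [hlat, mem_latticeSubgroup]
    have h1 : q (φ γ) = 0 ↔ ψ (π γ) = 1 := by
      simp only [q, MulEquiv.symm_apply_apply]
      exact Iff.rfl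
    rw [h1, map_eq_one_iff ψ ψ.injective]
    exact Subtype.ext_iff
  have hsurj : Function.Surjective q := by
    intro v
    obtain ⟨γ, hγ⟩ := (linearPart n).subgroupMap_surjective Γ (ψ.symm fun i => .ofAdd (v i))
    refine ⟨φ γ, ?_⟩
    have h1 : ψ (π γ) = fun i => .ofAdd (v i) :=
      (congrArg ψ hγ).trans (ψ.apply_symm_apply _)
    funext i
    simp only [q, MulEquiv.symm_apply_apply, h1]
    rfl
  obtain ⟨L, M, hMq, hc, hr⟩ := exists_diagModel hd (fun γ hγ m hm h => by
      have h1 := hΓ.torsionFree (φ.symm ⟨γ, hγ⟩) (φ.symm ⟨γ, hγ⟩).2 m hm (by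
        have h2 : (⟨γ, hγ⟩ : Γ') ^ m = 1 := Subtype.ext h
        have h3 := congrArg φ.symm h2
        rw [map_pow, map_one] at h3
        exact congrArg Subtype.val h3)
      have h2 : φ.symm ⟨γ, hγ⟩ = 1 := Subtype.ext h1
      rw [map_eq_one_iff _ φ.symm.injective] at h2
      exact congrArg Subtype.val h2)
    (q := q) (fun γ δ => by
      funext i
      simp only [q, map_mul]
      rfl) hsurj hker
  obtain ⟨d, hdle, L', hq, hc', hs'⟩ := L.exists_quotient hk1 hk4 hc hr
  obtain ⟨M', hM'⟩ := M.nonempty_of_isQuotient hq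
  let f : Γ →* EuclIsom d := M'.toIsom.comp φ.toMonoidHom
  have hrange : f.range = M'.toIsom.range := by
    ext g
    constructor
    · rintro ⟨γ, rfl⟩
      exact ⟨φ γ, rfl⟩
    · rintro ⟨γ, rfl⟩
      exact ⟨φ.symm γ, by simp [f]⟩
  refine ⟨f.ker, inferInstance, fun γ hγ => ?_, d, hdle, M'.toIsom.range,
    M'.isBieberbach_range hc', M'.isDiagonalType_range hs',
    ⟨(QuotientGroup.quotientKerEquivRange f).trans (MulEquiv.subgroupCongr hrange)⟩⟩
  have h1 := ((M'.toIsom_eq_one_iff hc').1 hγ).1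
  rw [← hlat, ← hker, ← hMq, ← hM']
  exact h1

/-! ### The abstract group of a family and its isolated normal subgroups -/

namespace DiagData

variable {k : ℕ} {ι : Type}

lemma sgn_mul_self (a : ZMod 2) : sgn a * sgn a = 1 := by
  revert a; decide

lemma sgn_cast (a : ZMod 2) : ((sgn a : ℤ) : ZMod 2) = 1 := by
  revert a; decide

/-- The abstract diagonal group of a family: pairs `(v, x)` that stand for the isometry
`y ↦ (-1)^(χ v) y + x / 2`. -/
@[ext]
structure ModelGroup (L : DiagData k ι) where
  q : BoolVec k
  x : ι → ℤ
  parity : ∀ i, (x i : ZMod 2) = L.alpha i q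

namespace ModelGroup

variable {L : DiagData k ι}

instance : Mul L.ModelGroup := ⟨fun γ δ => ⟨γ.q + δ.q, fun i => γ.x i + sgn (L.chi i γ.q) * δ.x i,
  fun i => by rw [map_add, ← γ.parity, ← δ.parity]; push_cast; rw [sgn_cast, one_mul]⟩⟩

instance : One L.ModelGroup := ⟨⟨0, 0, fun i => by simp⟩⟩

instance : Inv L.ModelGroup := ⟨fun γ => ⟨γ.q, fun i => -(sgn (L.chi i γ.q) * γ.x i),
  fun i => by
    push_cast
    rw [sgn_cast, one_mul, γ.parity, CharTwo.neg_eq]⟩⟩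

lemma mul_q (γ δ : L.ModelGroup) : (γ * δ).q = γ.q + δ.q := rfl

lemma mul_x (γ δ : L.ModelGroup) (i : ι) : (γ * δ).x i = γ.x i + sgn (L.chi i γ.q) * δ.x i := rfl

lemma one_q : (1 : L.ModelGroup).q = 0 := rfl

lemma one_x : (1 : L.ModelGroup).x = 0 := rfl

lemma inv_q (γ : L.ModelGroup) : γ⁻¹.q = γ.q := rfl

lemma inv_x (γ : L.ModelGroup) (i : ι) : γ⁻¹.x i = -(sgn (L.chi i γ.q) * γ.x i) := rfl

instance : Group L.ModelGroup := Group.ofLeftAxioms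
  (fun γ δ η => by
    ext i
    · simp only [mul_q, add_assoc]
    · simp only [mul_x, mul_q, map_add, sgn_add]
      ring)
  (fun γ => by
    ext i
    · rw [mul_q, one_q, zero_add]
    · rw [mul_x, one_q, one_x, map_zero, sgn_zero]
      simp)
  (fun γ => by
    ext i
    · rw [mul_q, inv_q, boolVec_add_self]; rfl
    · rw [mul_x, inv_q, inv_x, one_x]
      simp)

/-- The translations by integer vectors. -/
def translation (L : DiagData k ι) : Multiplicative (ι → ℤ) →* L.ModelGroup :=
  MonoidHom.mk' (fun y => ⟨0, fun i => 2 * y.toAdd i, fun i => by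
    rw [map_zero, ZMod.intCast_zmod_eq_zero_iff_dvd]
    exact ⟨_, rfl⟩⟩) <| by
    intro y z
    ext i
    · rw [mul_q, add_zero]
    · rw [mul_x, map_zero, sgn_zero, one_mul]
      exact mul_add _ _ _

lemma translation_q (y : Multiplicative (ι → ℤ)) : (translation L y).q = 0 := rfl

lemma translation_x (y : Multiplicative (ι → ℤ)) (i : ι) :
    (translation L y).x i = 2 * y.toAdd i := rfl

lemma conj_translation (γ : L.ModelGroup) (y : ι → ℤ) :
    γ * translation L (.ofAdd y) * γ⁻¹ =
      translation L (.ofAdd fun i => sgn (L.chi i γ.q) * y i) := by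
  rw [mul_inv_eq_iff_eq_mul]
  ext i
  · rw [mul_q, mul_q, translation_q, translation_q, add_comm]
  · rw [mul_x, mul_x, translation_q, translation_x, translation_x, map_zero, sgn_zero]
    simp only [toAdd_ofAdd]
    ring

lemma exists_q_eq (L : DiagData k ι) (v : BoolVec k) : ∃ γ : L.ModelGroup, γ.q = v :=
  ⟨⟨v, fun i => (L.alpha i v).val, fun i => by simp⟩, rfl⟩

/-- The tautological model. -/
def model (L : DiagData k ι) : DiagModel L.ModelGroup L where
  q := q
  x := x
  q_mul := mul_q
  q_surjective := exists_q_eq L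
  x_mul := mul_x
  parity := parity
  exists_translation y := ⟨translation L (.ofAdd y), rfl, fun _ => rfl⟩

section IsolatedSubgroups

variable {N : Subgroup L.ModelGroup} [hN : N.Normal]

open Classical in
/-- Conjugation eliminates the coordinates whose character differs from that of `i`. -/
lemma exists_translation_mem_eliminate {i : ι} {y : ι → ℤ} (hy : translation L (.ofAdd y) ∈ N)
    (hyi : y i ≠ 0) (J : Finset ι) (hJ : ∀ j ∈ J, L.chi i ≠ L.chi j) :
    ∃ z : ι → ℤ, translation L (.ofAdd z) ∈ N ∧ z i ≠ 0 ∧ ∀ j ∈ J, z j = 0 := by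
  induction J using Finset.induction_on with
  | empty => exact ⟨y, hy, hyi, by simp⟩
  | insert j J _ ih =>
    obtain ⟨z, hz, hzi, hzJ⟩ := ih fun l hl => hJ l (Finset.mem_insert_of_mem hl)
    obtain ⟨v, hv⟩ : ∃ v, L.chi i v ≠ L.chi j v := by
      by_contra! h
      exact hJ j (Finset.mem_insert_self _ _) (LinearMap.ext h)
    obtain ⟨γ, rfl⟩ := exists_q_eq L v
    have hs : sgn (L.chi i γ.q) * sgn (L.chi j γ.q) = -1 := by
      have key : ∀ a b : ZMod 2, a ≠ b → sgn a * sgn b = -1 := by decide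
      exact key _ _ hv
    -- The characters differ at `γ.q`, so entry `i` is doubled and entry `j` cancels; entries
    -- already zero stay zero.
    refine ⟨z + sgn (L.chi i γ.q) • fun l => sgn (L.chi l γ.q) * z l, ?_, ?_, ?_⟩
    · rw [ofAdd_add, map_mul, ofAdd_zsmul, map_zpow, ← conj_translation]
      exact N.mul_mem hz (N.zpow_mem (hN.conj_mem _ hz γ) _)
    · simp only [Pi.add_apply, Pi.smul_apply, smul_eq_mul]
      rw [← mul_assoc, sgn_mul_self]
      omega
    · intro l hl
      simp only [Pi.add_apply, Pi.smul_apply, smul_eq_mul]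
      rcases Finset.mem_insert.1 hl with rfl | hl
      · rw [← mul_assoc, hs]
        ring
      · rw [hzJ l hl]
        simp

/-- An isolated normal subgroup of the lattice has zero coordinates where the character is
isolated and some point is only covered by that coordinate. -/
lemma eq_zero_of_translation_mem [Fintype ι] (hNq : ∀ γ ∈ N, γ.q = 0)
    (htf : ∀ γ : L.ModelGroup, ∀ m : ℕ, 0 < m → γ ^ m ∈ N → γ ∈ N) {i : ι} {p : BoolVec k}
    (hp : ∀ j, L.Covers j p ↔ j = i) (hχ : ∀ j, j ≠ i → L.chi i ≠ L.chi j) {y : ι → ℤ}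
    (hy : translation L (.ofAdd y) ∈ N) : y i = 0 := by
  classical
  by_contra hyi
  obtain ⟨z, hz, hzi, hz0⟩ := exists_translation_mem_eliminate hy hyi (Finset.univ.erase i)
    fun j hj => hχ j (Finset.ne_of_mem_erase hj)
  have hcov := (hp i).2 rfl
  -- A square root of the unit translation along `i`. As only `i` covers `p`, entries with trivial
  -- sign can be 0; those with sign -1 vanish on squaring.
  let γ : L.ModelGroup :=
    { q := p
      x := fun j => if j = i then 1 else if L.chi j p = 0 then 0 else (L.alpha j p).val
      parity := fun j => by
        by_cases hji : j = i
        · subst hji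
          simp [hcov.2]
        · by_cases hj : L.chi j p = 0
          · rw [if_neg hji, if_pos hj, Int.cast_zero]
            by_contra h
            exact hji ((hp j).1 ⟨hj, zmod_two_eq_one (Ne.symm h)⟩)
          · rw [if_neg hji, if_neg hj]
            simp }
  have hsq : γ ^ 2 = translation L (.ofAdd (Pi.single i 1)) := by
    rw [pow_two]
    ext j
    · rw [mul_q, boolVec_add_self, translation_q]
    · rw [mul_x, translation_x, toAdd_ofAdd]
      change γ.x j + sgn (L.chi j p) * γ.x j = _
      by_cases hji : j = i
      · subst hji
        simp [γ, hcov.1, sgn]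
      · by_cases hj : L.chi j p = 0
        · simp [γ, hji, hj]
        · simp [γ, hji, hj, sgn]
  have hzs : translation L (.ofAdd z) = (translation L (.ofAdd (Pi.single i 1))) ^ z i := by
    rw [← map_zpow, ← ofAdd_zsmul]
    congr 2
    funext j
    by_cases hji : j = i
    · subst hji; simp
    · simp [hji, hz0 j (by simp [hji])]
  have hmem : γ ^ (2 * (z i).natAbs) ∈ N := by
    rw [pow_mul, hsq]
    rw [hzs] at hz
    rcases Int.natAbs_eq (z i) with h | h
    · rw [h, zpow_natCast] at hz
      exact hz
    · rw [h, zpow_neg, zpow_natCast, inv_mem_iff] at hz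
      exact hz
  have hγ : p = 0 := hNq γ (htf γ _ (by positivity) hmem)
  have := hcov.2
  simp [hγ] at this

end IsolatedSubgroups

end ModelGroup

end DiagData

/-! ### Surviving coordinates and the lower bound -/

section LowerBound

open DiagData ModelGroup

variable {k n m : ℕ}

lemma nonempty_holonomyGroup_mulEquiv {L : DiagData k (Fin n)} (hr : L.radical = ⊥) :
    Nonempty (holonomyGroup (model L).toIsom.range ≃* C2Pow k) := by
  let σ : C2Pow k →* (EuclideanSpace ℝ (Fin n) ≃ₗᵢ[ℝ] EuclideanSpace ℝ (Fin n)) :=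
    MonoidHom.mk' (fun v => signIsometry fun i => L.chi i fun l => (v l).toAdd) <| by
      intro v w
      ext u i
      change _ = signIsometry _ (signIsometry _ u) i
      rw [signIsometry_apply, signIsometry_apply, signIsometry_apply]
      have : (fun l => ((v * w) l).toAdd) = (fun l => (v l).toAdd) + fun l => (w l).toAdd := rfl
      rw [this, map_add, sgn_add]
      push_cast
      ring
  have hinj : Function.Injective σ := by
    rw [injective_iff_map_eq_one]
    intro v hv
    have h1 := signIsometry_eq_one_iff.1 hv
    have h2 : (fun l => (v l).toAdd) ∈ L.radical := mem_radical.2 (congrFun h1)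
    rw [hr, Submodule.mem_bot] at h2
    exact h2
  have hrange : σ.range = holonomyGroup (model L).toIsom.range := by
    ext A
    constructor
    · rintro ⟨v, rfl⟩
      obtain ⟨γ, hγ⟩ := exists_q_eq L fun l => (v l).toAdd
      refine ⟨(model L).toIsom γ, ⟨γ, rfl⟩, ?_⟩
      rw [DiagModel.linearPart_toIsom]
      change signIsometry (fun i => L.chi i γ.q) = _
      rw [hγ]
      rfl
    · rintro ⟨_, ⟨γ, rfl⟩, rfl⟩
      exact ⟨fun l => .ofAdd (γ.q l), ((model L).linearPart_toIsom γ).symm⟩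
  exact ⟨((MonoidHom.ofInjective hinj).trans (MulEquiv.subgroupCongr hrange)).symm⟩

/-- A free abelian subgroup of a group with diagonal holonomy has rank at most the dimension. -/
lemma le_of_injective_of_hasDiagonalHolonomy {Γ : Subgroup (EuclIsom n)}
    (hd : HasDiagonalHolonomy Γ) (htf : ∀ γ : Γ, ∀ m : ℕ, 0 < m → γ ^ m = 1 → γ = 1)
    (g : Multiplicative (Fin m → ℤ) →* Γ) (hg : Function.Injective g) : m ≤ n := by
  obtain ⟨b, hspan, hb⟩ := hd
  have hlin : ∀ γ : Γ, linearPart n ((γ ^ 2 : Γ) : EuclIsom n) = 1 := by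
    intro γ
    have h1 : (linearPart n ((γ ^ 2 : Γ) : EuclIsom n)).toLinearEquiv.toLinearMap =
        LinearMap.id := by
      refine b.ext fun i => ?_
      have h2 : ((γ ^ 2 : Γ) : EuclIsom n) = (γ : EuclIsom n) * γ := by rw [pow_two]; rfl
      change linearPart n ((γ ^ 2 : Γ) : EuclIsom n) (b i) = b i
      rw [h2, map_mul]
      change linearPart n (γ : EuclIsom n) (linearPart n (γ : EuclIsom n) (b i)) = b i
      rcases hb γ γ.2 i with h | h
      · rw [h, h]
      · rw [h, map_neg, h, neg_neg]
    ext1 u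
    exact LinearMap.congr_fun h1 u
  let S := Submodule.span ℤ (Set.range b)
  -- Squares are translations because the signs square to 1, and squaring stays injective here
  -- because the group is torsion-free.
  let t : (Fin m → ℤ) →+ EuclideanSpace ℝ (Fin n) := AddMonoidHom.mk'
    (fun z => ((g (.ofAdd z) ^ 2 : Γ) : EuclIsom n) 0) <| by
      intro y z
      have hcomm : Commute (g (.ofAdd y)) (g (.ofAdd z)) := (Commute.all _ _).map g
      rw [ofAdd_add, map_mul, hcomm.mul_pow]
      change ((g (.ofAdd y) ^ 2 : Γ) : EuclIsom n) (((g (.ofAdd z) ^ 2 : Γ) : EuclIsom n) 0) = _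
      rw [euclIsom_apply ((g (.ofAdd y) ^ 2 : Γ) : EuclIsom n), hlin, add_comm]
      rfl
  have htS : ∀ z, t z ∈ S := by
    intro z
    rw [← hspan]
    change AffineIsometryEquiv.constVAdd ℝ _ (((g (.ofAdd z) ^ 2 : Γ) : EuclIsom n) 0) ∈ Γ
    rw [← eq_constVAdd_of_linearPart_eq_one (hlin _)]
    exact (g (.ofAdd z) ^ 2).2
  let f : (Fin m → ℤ) →ₗ[ℤ] S := LinearMap.codRestrict S t.toIntLinearMap htS
  have hf : Function.Injective f := by
    rw [injective_iff_map_eq_zero]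
    intro z hz
    have hz : ((g (.ofAdd z) ^ 2 : Γ) : EuclIsom n) 0 = 0 := congrArg Subtype.val hz
    have h1 : g (.ofAdd z) ^ 2 = 1 := by
      apply Subtype.ext
      rw [eq_constVAdd_of_linearPart_eq_one (hlin (g (.ofAdd z))), hz,
        AffineIsometryEquiv.constVAdd_zero]
      rfl
    have h2 := htf _ 2 two_pos h1
    rw [map_eq_one_iff g hg] at h2
    exact h2
  let B := b.restrictScalars ℤ
  have : Module.Finite ℤ S := Module.Finite.of_basis B
  have hle := LinearMap.finrank_le_finrank_of_injective hf
  rw [Module.finrank_fin_fun, Module.finrank_eq_card_basis B, Fintype.card_fin] at hle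
  exact hle

/-- Coordinates that have an isolated character and a private point survive in every Bieberbach
quotient by a subgroup of the lattice. -/
theorem DiagonalVasquezBound.le_of_private {d : ℕ} (h : DiagonalVasquezBound (C2Pow k) d)
    (L : DiagData k (Fin n)) (hc : L.IsCover) (hr : L.radical = ⊥) {e : Fin m → Fin n}
    (he : Function.Injective e) {p : Fin m → BoolVec k}
    (hp : ∀ i j, L.Covers j (p i) ↔ j = e i) (hχ : ∀ i j, j ≠ e i → L.chi (e i) ≠ L.chi j) :
    m ≤ d := by
  have hs : L.IsSplit := fun j => Or.inl fun w hw => by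
    rw [hr, Submodule.mem_bot] at hw
    rw [hw, map_zero]
  obtain ⟨N, hN, hNlat, d', hd', Γ₁, hΓ₁, ⟨Γ₂, -, hdiag, ⟨φ₂⟩⟩, ⟨φ₁⟩⟩ :=
    h n _ ((model L).isBieberbach_range hc) ((model L).isDiagonalType_range hs)
      (nonempty_holonomyGroup_mulEquiv hr)
  refine le_trans ?_ hd'
  have htf₁ : ∀ γ : Γ₁, ∀ m : ℕ, 0 < m → γ ^ m = 1 → γ = 1 := fun γ m hm hγ =>
    Subtype.ext (hΓ₁.torsionFree γ γ.2 m hm (congrArg Subtype.val hγ))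
  have htf₂ : ∀ γ : Γ₂, ∀ m : ℕ, 0 < m → γ ^ m = 1 → γ = 1 := by
    intro γ m hm hγ
    have := htf₁ (φ₂.symm γ) m hm (by rw [← map_pow, hγ, map_one])
    rwa [map_eq_one_iff _ φ₂.symm.injective] at this
  let π : L.ModelGroup →* Γ₁ :=
    φ₁.toMonoidHom.comp ((QuotientGroup.mk' N).comp (model L).toIsom.rangeRestrict)
  have hker : ∀ γ, π γ = 1 ↔ (model L).toIsom.rangeRestrict γ ∈ N := by
    intro γ
    change φ₁ (QuotientGroup.mk' N ((model L).toIsom.rangeRestrict γ)) = 1 ↔ _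
    rw [map_eq_one_iff φ₁ φ₁.injective, QuotientGroup.mk'_apply, QuotientGroup.eq_one_iff]
  have hq : ∀ γ ∈ π.ker, γ.q = 0 := by
    intro γ hγ
    have h1 := mem_latticeSubgroup.1 (hNlat ((hker γ).1 hγ))
    have h2 := (model L).linearPart_toIsom γ
    rw [show linearPart n ((model L).toIsom γ) = 1 from h1] at h2
    have h3 : γ.q ∈ L.radical :=
      mem_radical.2 (congrFun (signIsometry_eq_one_iff.1 h2.symm))
    rwa [hr, Submodule.mem_bot] at h3
  have hiso : ∀ γ : L.ModelGroup, ∀ m : ℕ, 0 < m → γ ^ m ∈ π.ker → γ ∈ π.ker := by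
    intro γ m hm hγ
    rw [MonoidHom.mem_ker, map_pow] at hγ
    exact htf₁ _ m hm hγ
  let E : Multiplicative (Fin m → ℤ) →* Multiplicative (Fin n → ℤ) :=
    AddMonoidHom.toMultiplicative (Function.ExtendByZero.linearMap ℤ e).toAddMonoidHom
  refine le_of_injective_of_hasDiagonalHolonomy hdiag htf₂
    (φ₂.toMonoidHom.comp (π.comp ((translation L).comp E))) ?_
  rw [injective_iff_map_eq_one]
  intro z hz
  have hz : φ₂ (π (translation L (E z))) = 1 := hz
  rw [map_eq_one_iff φ₂ φ₂.injective] at hz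
  have hzero : ∀ i, z.toAdd i = 0 := by
    intro i
    have h1 := eq_zero_of_translation_mem (N := π.ker) hq hiso (hp i) (hχ i)
      (y := (E z).toAdd) hz
    have h2 : (E z).toAdd (e i) = z.toAdd i := he.extend_apply _ _ _
    rw [← h2, h1]
  exact funext hzero

end LowerBound

/-! ### Explicit extremal families -/

/-- The functional `v ↦ ∑ i, c i * v i`. -/
def dotDual {k : ℕ} (c : BoolVec k) : BoolDual k where
  toFun v := ∑ i, c i * v i
  map_add' v w := by simp [mul_add, Finset.sum_add_distrib]
  map_smul' a v := by simp [Finset.mul_sum, mul_left_comm]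

/-- The family of functionals with the given coefficient vectors. -/
def DiagData.ofRows {k n : ℕ} (C A : Fin n → BoolVec k) : DiagData k (Fin n) :=
  ⟨fun i => dotDual (C i), fun i => dotDual (A i)⟩

/-- `DiagonalVasquezBound.le_of_private` with hypotheses that can be decided. -/
lemma DiagonalVasquezBound.le_of_rows {k m n d : ℕ} (h : DiagonalVasquezBound (C2Pow k) d)
    (C A : Fin n → BoolVec k) (e : Fin m → Fin n) (p : Fin m → BoolVec k)
    (hc : ∀ v, v ≠ 0 → ∃ i, dotDual (C i) v = 0 ∧ dotDual (A i) v = 1)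
    (hr : ∀ v, (∀ i, dotDual (C i) v = 0) → v = 0)
    (he : ∀ i j, e i = e j → i = j)
    (hp : ∀ i j, (dotDual (C j) (p i) = 0 ∧ dotDual (A j) (p i) = 1) ↔ j = e i)
    (hχ : ∀ i j, j ≠ e i → ∃ l, C (e i) l ≠ C j l) : m ≤ d := by
  refine h.le_of_private (DiagData.ofRows C A) hc ?_ (e := e) (fun i j => he i j) hp ?_
  · rw [eq_bot_iff]
    exact fun v hv => hr v (DiagData.mem_radical.1 hv)
  · intro i j hij heq
    obtain ⟨l, hl⟩ := hχ i j hij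
    apply hl
    have := LinearMap.congr_fun heq (Pi.single l 1)
    simpa [DiagData.ofRows, dotDual, Pi.single_apply] using this

/-- The Klein bottle group; only its first coordinate survives. -/
lemma DiagonalVasquezBound.one_le {d : ℕ} (h : DiagonalVasquezBound (C2Pow 1) d) : 1 ≤ d :=
  h.le_of_rows ![![0], ![1]] ![![1], ![0]] ![0] ![![1]] (by decide) (by decide) (by decide)
    (by decide) (by decide)

/-- The three-dimensional Hantzsche–Wendt group. -/
lemma DiagonalVasquezBound.three_le {d : ℕ} (h : DiagonalVasquezBound (C2Pow 2) d) : 3 ≤ d :=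
  h.le_of_rows ![![0, 1], ![1, 0], ![1, 1]] ![![1, 0], ![0, 1], ![1, 0]] id
    ![![1, 0], ![0, 1], ![1, 1]] (by decide) (by decide) (by decide) (by decide) (by decide)

lemma DiagonalVasquezBound.five_le {d : ℕ} (h : DiagonalVasquezBound (C2Pow 3) d) : 5 ≤ d :=
  h.le_of_rows ![![0, 0, 1], ![0, 1, 0], ![0, 1, 1], ![1, 1, 1], ![1, 1, 0]]
    ![![1, 1, 0], ![1, 0, 1], ![1, 1, 0], ![1, 0, 0], ![1, 0, 0]] id
    ![![0, 1, 0], ![0, 0, 1], ![0, 1, 1], ![1, 0, 1], ![1, 1, 1]]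
    (by decide) (by decide) (by decide) (by decide) (by decide)

set_option maxRecDepth 10000 in
-- The equality case of the triple count: the private points are the vectors of weight two and
-- three, and the five others are the unit vectors and the all-ones vector.
lemma DiagonalVasquezBound.ten_le {d : ℕ} (h : DiagonalVasquezBound (C2Pow 4) d) : 10 ≤ d :=
  h.le_of_rows
    ![![0, 0, 0, 1], ![0, 0, 1, 0], ![0, 0, 1, 1], ![0, 1, 0, 0], ![0, 1, 0, 1],
      ![0, 1, 1, 0], ![1, 0, 0, 0], ![1, 0, 0, 1], ![1, 0, 1, 0], ![1, 1, 0, 0]]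
    ![![1, 1, 1, 0], ![1, 1, 0, 1], ![1, 1, 1, 0], ![1, 0, 1, 1], ![1, 1, 1, 0],
      ![1, 1, 0, 1], ![0, 1, 1, 1], ![1, 1, 1, 0], ![1, 1, 0, 1], ![1, 0, 1, 1]] id
    ![![1, 1, 1, 0], ![1, 1, 0, 1], ![0, 0, 1, 1], ![1, 0, 1, 1], ![0, 1, 0, 1],
      ![0, 1, 1, 0], ![0, 1, 1, 1], ![1, 0, 0, 1], ![1, 0, 1, 0], ![1, 1, 0, 0]]
    (by decide +kernel) (by decide +kernel) (by decide) (by decide +kernel) (by decide +kernel)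

theorem theoremB :
    IsDiagonalVasquezInvariant (C2Pow 1) 1 ∧
    IsDiagonalVasquezInvariant (C2Pow 2) 3 ∧
    IsDiagonalVasquezInvariant (C2Pow 3) 5 ∧
    IsDiagonalVasquezInvariant (C2Pow 4) 10 :=
  ⟨⟨diagonalVasquezBound_vasquezValue (by norm_num) (by norm_num), fun _ h => h.one_le⟩,
    ⟨diagonalVasquezBound_vasquezValue (by norm_num) (by norm_num), fun _ h => h.three_le⟩,
    ⟨diagonalVasquezBound_vasquezValue (by norm_num) (by norm_num), fun _ h => h.five_le⟩,
    ⟨diagonalVasquezBound_vasquezValue (by norm_num) (by norm_num), fun _ h => h.ten_le⟩⟩
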